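/- **Setting.** Let $M$ be a compact second countable Hausdorff space and let $M\times M$ be its pair groupoid; the arrow $(x,y)$ has domain $y$ and range $x$. A *Fell bundle* over $M\times M$ is a Banach bundle $E\to M\times M$ (with continuous norm) with a continuous associative bilinear multiplication $E_{(x,y)}\times E_{(y,z)}\to E_{(x,z)}$ and a continuous conjugate linear involution $E_{(x,y)}\to E_{(y,x)}$, such that $\|ab\|\le\|a\|\|b\|$, $a^{**}=a$, $(ab)^*=b^*a^*$, $\|a^*a\|=\|a\|^2$ and $a^*a\ge 0$ in the C*-algebra $E_{(y,y)}$ for $a\in E_{(x,y)}$. It is *saturated* if $E_{(x,y)}E_{(y,z)}$ is total in $E_{(x,z)}$ for all $x,y,z$, and *unital* if every C*-algebra $E_{(x,x)}$ has an identity element. A *Fell bundle triple* $(E,H,PL)$ over $M$ consists of * a unital saturated Fell bundle $E$ over $M\times M$; * a Hilbert space $H$ with a faithful nondegenerate representation of a C*-completion $C^*(E)$ of the convolution $*$-algebra of continuous sections of $E$, where $(f*g)(x,z)=\int f(x,y)g(y,z)\,d\mu(y)$ for a finite Borel measure $\mu$ of full support on $M$ and $f^*(x,y)=f(y,x)^*$,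 and with the compatible representation of the algebra $C^*(E^0)$ of continuous sections of the restriction of $E$ to the units; * a path-lifting operator: a homeomorphism $\varphi$ of $M$ (that is, a global bisection $\{(\varphi(x),x)\}$), a continuous section $x\mapsto e_x\in E_{(\varphi(x),x)}$ of $E$ along it which is consistent, i.e. $\varphi(\varphi(x))=x$ and $e_{\varphi(x)}=e_x^*$, and a bounded operator $PL$ on $H$ which extends the section: $PL$ composed with the action of a section $f$ is the action of the section $(\varphi(x),z)\mapsto e_x f(x,z)$. Morphisms of Fell bundle triples are the continuous, fibrewise linear, multiplicative, involutive, unital bundle maps over continuous maps of the base spaces that carry the first path-lifting section to the second. A *spectral C\*-category* with space of objects $M$ is a C*-category with object space $M$, whose morphisms form a Banach bundle over $M\times M$ (with fibre $\mathrm{Hom}(y,x)$ over $(x,y)$) with continuous composition and involution, which is full (the products of morphisms $x\to y$ and $y\to x$ span a dense subspace of $\mathrm{Hom}(x,x)$ for all $x,y$), together with a continuous section $\sigma$ of the domain map $d$ such that $r\circ\sigma$ is bijective, where $r$ is the range map, and which is self-adjoint: $\sigma(r(\sigma(x)))=\sigma(x)^*$ for all $x$. Morphisms of spectral C*-categories are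 the linear $*$-functors, continuous on objects and on morphisms, that carry the first section to the second. **Proposition.** Let $\mathcal P$ be any class of topological spaces (for example the simply connected compact manifolds, or all spaces), and consider only those $M$ that lie in $\mathcal P$. Assign to a Fell bundle triple $(E,H,PL)$ over $M$ the category with object space $M$, with $\mathrm{Hom}(y,x)=E_{(x,y)}$ and the operations and topology of $E$, and with the section $\sigma(x)=e_x$ that underlies $PL$. This defines a functor from Fell bundle triples to spectral C*-categories, and it is an equivalence of categories. Moreover, the operator and the section correspond to each other: for a given $E$ and a given represented Hilbert space $H$ as above, two path-lifting operators over the same bisection are equal as operators on $H$ if and only if their underlying sections are equal. -/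

import Mathlib

open CategoryTheory Topology MeasureTheory

universe u

/-! ### Banach bundles -/

/-- The total space of a family of fibres (an own structure, so that it carries no default topology). -/
@[ext]
structure Tot {X : Type u} (E : X → Type u) where
  base : X
  val : E base

/-- The fibre product of a family of fibres with itself over the base. -/
structure FibreProd {X : Type u} (E : X → Type u) where
  base : X
  fst : E base
  snd : E base

/-- The fibre product is topologised as a subspace of the square of the total space. -/
instance FibreProd.topology {X : Type u} (E : X → Type u) [TopologicalSpace (Tot E)] :
    TopologicalSpace (FibreProd E) :=
  TopologicalSpace.induced
    (fun p => ((⟨p.base, p.fst⟩ : Tot E), (⟨p.base, p.snd⟩ : Tot E))) inferInstance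

/-- A family of complex Banach spaces, together with a topology on its total space,
is a Banach bundle (with continuous norm). -/
structure IsBanachBundle {X : Type u} [TopologicalSpace X] (E : X → Type u)
    [∀ x, NormedAddCommGroup (E x)] [∀ x, NormedSpace ℂ (E x)] [TopologicalSpace (Tot E)] :
    Prop where
  complete : ∀ x, CompleteSpace (E x)
  continuous_proj : Continuous (Tot.base : Tot E → X)
  isOpenMap_proj : IsOpenMap (Tot.base : Tot E → X)
  continuous_add : Continuous (fun p : FibreProd E => (⟨p.base, p.fst + p.snd⟩ : Tot E))
  continuous_smul : Continuous (fun p : ℂ × Tot E => (⟨p.2.base, p.1 • p.2.val⟩ : Tot E))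
  continuous_norm : Continuous (fun e : Tot E => ‖e.val‖)
  nhds_zero : ∀ x : X, (𝓝 (⟨x, 0⟩ : Tot E)).HasBasis
    (fun p : Set X × ℝ => IsOpen p.1 ∧ x ∈ p.1 ∧ 0 < p.2)
    (fun p => {e : Tot E | e.base ∈ p.1 ∧ ‖e.val‖ < p.2})

/-- The vector space of continuous sections of a Banach bundle. -/
def continuousSections {X : Type u} [TopologicalSpace X] {E : X → Type u}
    [∀ x, NormedAddCommGroup (E x)] [∀ x, NormedSpace ℂ (E x)] [TopologicalSpace (Tot E)]
    (hE : IsBanachBundle E) : Submodule ℂ (∀ x, E x) where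
  carrier := {f | Continuous (fun x => (⟨x, f x⟩ : Tot E))}
  zero_mem' := by
    refine continuous_iff_continuousAt.2 fun x => ?_
    refine (hE.nhds_zero x).tendsto_right_iff.2 fun p hp => ?_
    filter_upwards [hp.1.mem_nhds hp.2.1] with y hy
    exact ⟨hy, by simpa using hp.2.2⟩
  add_mem' := by
    intro f g hf hg
    have h : Continuous (fun x => (⟨x, f x, g x⟩ : FibreProd E)) :=
      continuous_induced_rng.2 (Continuous.prodMk hf hg)
    exact hE.continuous_add.comp h
  smul_mem' := by
    intro c f hf
    exact hE.continuous_smul.comp (Continuous.prodMk continuous_const hf)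

/-! ### Composable arrows over a pair groupoid

The pair groupoid over `M` is `M × M`; the arrow `(x, y)` has range `x` and domain `y`, so that
`(x, y) (y, z) = (x, z)` and `(x, y)⁻¹ = (y, x)`. -/

/-- Pairs of elements of a bundle over the pair groupoid lying over composable arrows. -/
structure Composable {M : Type u} (E : M × M → Type u) where
  x : M
  y : M
  z : M
  left : E (x, y)
  right : E (y, z)

/-- The set of composable pairs is topologised as a subspace of the square of the total space. -/
instance Composable.topology {M : Type u} (E : M × M → Type u) [TopologicalSpace (Tot E)] :
    TopologicalSpace (Composable E) :=
  TopologicalSpace.induced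
    (fun p => ((⟨(p.x, p.y), p.left⟩ : Tot E), (⟨(p.y, p.z), p.right⟩ : Tot E))) inferInstance

/-! ### Fell bundles over pair groupoids -/

/-- A Fell bundle over the pair groupoid `M × M` of a topological space `M`. -/
structure FellBundle (M : Type u) [TopologicalSpace M] where
  Fib : M × M → Type u
  [normed : ∀ g, NormedAddCommGroup (Fib g)]
  [space : ∀ g, NormedSpace ℂ (Fib g)]
  [top : TopologicalSpace (Tot Fib)]
  banach : IsBanachBundle Fib
  mul : ∀ {x y z : M}, Fib (x, y) → Fib (y, z) → Fib (x, z)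
  adj : ∀ {x y : M}, Fib (x, y) → Fib (y, x)
  continuous_mul : Continuous (fun p : Composable Fib => (⟨(p.x, p.z), mul p.left p.right⟩ : Tot Fib))
  continuous_adj : Continuous
    (fun e : Tot Fib => (⟨(e.base.2, e.base.1), adj e.val⟩ : Tot Fib))
  add_mul : ∀ {x y z : M} (a b : Fib (x, y)) (c : Fib (y, z)), mul (a + b) c = mul a c + mul b c
  mul_add : ∀ {x y z : M} (a : Fib (x, y)) (b c : Fib (y, z)), mul a (b + c) = mul a b + mul a c
  smul_mul : ∀ {x y z : M} (t : ℂ) (a : Fib (x, y)) (b : Fib (y, z)), mul (t • a) b = t • mul a b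
  mul_smul : ∀ {x y z : M} (t : ℂ) (a : Fib (x, y)) (b : Fib (y, z)), mul a (t • b) = t • mul a b
  mul_assoc : ∀ {w x y z : M} (a : Fib (w, x)) (b : Fib (x, y)) (c : Fib (y, z)),
    mul (mul a b) c = mul a (mul b c)
  norm_mul_le : ∀ {x y z : M} (a : Fib (x, y)) (b : Fib (y, z)), ‖mul a b‖ ≤ ‖a‖ * ‖b‖
  adj_add : ∀ {x y : M} (a b : Fib (x, y)), adj (a + b) = adj a + adj b
  adj_smul : ∀ {x y : M} (t : ℂ) (a : Fib (x, y)), adj (t • a) = (starRingEnd ℂ t) • adj a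
  adj_adj : ∀ {x y : M} (a : Fib (x, y)), adj (adj a) = a
  adj_mul : ∀ {x y z : M} (a : Fib (x, y)) (b : Fib (y, z)), adj (mul a b) = mul (adj b) (adj a)
  norm_adj_mul : ∀ {x y : M} (a : Fib (x, y)), ‖mul (adj a) a‖ = ‖a‖ ^ 2
  /-- `a* a` is a positive element of the C*-algebra over the unit `(y, y)`. -/
  adj_mul_pos : ∀ {x y : M} (a : Fib (x, y)), ∃ b : Fib (y, y), mul (adj a) a = mul (adj b) b

namespace FellBundle

attribute [instance] FellBundle.normed FellBundle.space FellBundle.top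

variable {M : Type u} [TopologicalSpace M]

/-- `E_g E_h` is total in `E_{gh}` for all composable arrows `g`, `h`. -/
def IsSaturated (E : FellBundle M) : Prop :=
  ∀ x y z : M, Dense (Submodule.span ℂ
    (Set.range (fun p : E.Fib (x, y) × E.Fib (y, z) => E.mul p.1 p.2)) : Set (E.Fib (x, z)))

/-- `u` is an identity element of the C*-algebra over the unit `(x, x)`. -/
def IsIdentity (E : FellBundle M) {x : M} (u : E.Fib (x, x)) : Prop :=
  ∀ a : E.Fib (x, x), E.mul u a = a ∧ E.mul a u = a

/-- Every C*-algebra over a unit of the groupoid has an identity element. -/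
def IsUnital (E : FellBundle M) : Prop :=
  ∀ x : M, ∃ u : E.Fib (x, x), E.IsIdentity u

/-- The identity element of the C*-algebra over `(x, x)`. -/
noncomputable def one (E : FellBundle M) (h : E.IsUnital) (x : M) : E.Fib (x, x) :=
  Classical.choose (h x)

theorem one_isIdentity (E : FellBundle M) (h : E.IsUnital) (x : M) : E.IsIdentity (E.one h x) :=
  Classical.choose_spec (h x)

theorem IsIdentity.eq {E : FellBundle M} {x : M} {u v : E.Fib (x, x)} (hu : E.IsIdentity u)
    (hv : E.IsIdentity v) : u = v :=
  (hv u).2.symm.trans (hu v).1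

theorem sub_mul (E : FellBundle M) {x y z : M} (a b : E.Fib (x, y)) (c : E.Fib (y, z)) :
    E.mul (a - b) c = E.mul a c - E.mul b c := by
  rw [eq_sub_iff_add_eq, ← E.add_mul, sub_add_cancel]

theorem mul_sub (E : FellBundle M) {x y z : M} (a : E.Fib (x, y)) (b c : E.Fib (y, z)) :
    E.mul a (b - c) = E.mul a b - E.mul a c := by
  rw [eq_sub_iff_add_eq, ← E.mul_add, sub_add_cancel]

theorem eq_zero_of_adj_mul (E : FellBundle M) {x y : M} (a : E.Fib (x, y))
    (h : E.mul (E.adj a) a = 0) : a = 0 := by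
  have := E.norm_adj_mul a
  rw [h, norm_zero] at this
  exact norm_eq_zero.1 (pow_eq_zero_iff (two_ne_zero)|>.1 this.symm)

theorem adj_zero (E : FellBundle M) {x y : M} : E.adj (0 : E.Fib (x, y)) = 0 := by
  have := E.adj_add (0 : E.Fib (x, y)) 0
  simpa using this

theorem mul_identity (E : FellBundle M) {x y : M} {u : E.Fib (y, y)} (hu : E.IsIdentity u)
    (a : E.Fib (x, y)) : E.mul a u = a := by
  refine sub_eq_zero.1 (E.eq_zero_of_adj_mul _ ?_)
  rw [E.mul_sub, ← E.mul_assoc, (hu _).2, sub_self]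

theorem identity_mul (E : FellBundle M) {x y : M} {u : E.Fib (x, x)} (hu : E.IsIdentity u)
    (a : E.Fib (x, y)) : E.mul u a = a := by
  have h : E.adj (E.mul u a - a) = 0 := by
    refine E.eq_zero_of_adj_mul _ ?_
    rw [E.adj_adj, E.sub_mul, E.mul_assoc, (hu _).1, sub_self]
  have h2 := E.adj_adj (E.mul u a - a)
  rw [h, E.adj_zero] at h2
  exact sub_eq_zero.1 h2.symm

/-- The involution on the total space. -/
def totAdj (E : FellBundle M) (e : Tot E.Fib) : Tot E.Fib :=
  ⟨(e.base.2, e.base.1), E.adj e.val⟩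

/-- The continuous sections of the bundle; over a compact space all of them are compactly
supported. -/
abbrev sections (E : FellBundle M) : Submodule ℂ (∀ g, E.Fib g) :=
  continuousSections E.banach

/-- The continuous sections of the C*-bundle `E⁰`, the restriction of `E` to the unit space. -/
def IsDiagSection (E : FellBundle M) (a : ∀ x : M, E.Fib (x, x)) : Prop :=
  Continuous (fun x => (⟨(x, x), a x⟩ : Tot E.Fib))

/-- The vector space of continuous sections of the C*-bundle `E⁰`. With pointwise operations and
supremum norm it is the C*-algebra `C*(E⁰)` when `M` is compact. -/
def diagSections (E : FellBundle M) : Submodule ℂ (∀ x : M, E.Fib (x, x)) where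
  carrier := {a | E.IsDiagSection a}
  zero_mem' := by
    have h : Continuous (fun g : M × M => (⟨g, 0⟩ : Tot E.Fib)) := E.sections.zero_mem
    exact h.comp (Continuous.prodMk continuous_id continuous_id)
  add_mem' := by
    intro f g hf hg
    have h : Continuous (fun x => (⟨(x, x), f x, g x⟩ : FibreProd E.Fib)) :=
      continuous_induced_rng.2 (Continuous.prodMk hf hg)
    exact E.banach.continuous_add.comp h
  smul_mem' := by
    intro c f hf
    exact E.banach.continuous_smul.comp (Continuous.prodMk continuous_const hf)

end FellBundle

/-! ### The C*-algebra of a Fell bundle and its representations -/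

/-- A C*-completion `C*(E)` of the convolution algebra of (compactly supported) continuous sections
of `E`, with respect to the Haar system `δ_x × μ` of the pair groupoid. Here the product of `f` and
`g` is `(f * g)(x, z) = ∫ f(x, y) g(y, z) dμ(y)`, which is again a continuous section, and
`f*(x, y) = f(y, x)*`. -/
structure FellBundle.Completion {M : Type u} [TopologicalSpace M] {_ : MeasurableSpace M}
    (E : FellBundle M) (μ : Measure M) where
  Alg : Type u
  [cstar : NonUnitalCStarAlgebra Alg]
  ι : E.sections →ₗ[ℂ] Alg
  injective : Function.Injective ι
  denseRange : DenseRange ι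
  map_conv : ∀ f g h : E.sections,
    (∀ x z : M, h.1 (x, z) = ∫ y, E.mul (f.1 (x, y)) (g.1 (y, z)) ∂μ) → ι h = ι f * ι g
  map_star : ∀ f h : E.sections,
    (∀ x y : M, h.1 (x, y) = E.adj (f.1 (y, x))) → ι h = star (ι f)

attribute [instance] FellBundle.Completion.cstar

/-- A Hilbert space carrying a faithful nondegenerate representation of `C*(E)`, together with the
compatible representation of the diagonal algebra `C*(E⁰)`. -/
structure FellBundle.Representation {M : Type u} [TopologicalSpace M] (E : FellBundle M) where
  /-- The Borel measure giving the Haar system of the pair groupoid: finite, of full support. -/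
  μ : @Measure M (borel M)
  finite : IsFiniteMeasure μ
  openPos : μ.IsOpenPosMeasure
  completion : E.Completion μ
  H : Type u
  [normedH : NormedAddCommGroup H]
  [innerH : InnerProductSpace ℂ H]
  [completeH : CompleteSpace H]
  ρ : completion.Alg →⋆ₙₐ[ℂ] (H →L[ℂ] H)
  faithful : Function.Injective ρ
  nondegenerate : Dense (Submodule.span ℂ
    (Set.range (fun p : completion.Alg × H => ρ p.1 p.2)) : Set H)
  ρ₀ : E.diagSections →ₗ[ℂ] (H →L[ℂ] H)
  ρ₀_mul : ∀ a b c : E.diagSections, (∀ x, c.1 x = E.mul (a.1 x) (b.1 x)) → ρ₀ c = ρ₀ a * ρ₀ b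
  ρ₀_star : ∀ a b : E.diagSections, (∀ x, b.1 x = E.adj (a.1 x)) → ρ₀ b = star (ρ₀ a)
  /-- `C*(E⁰)` acts through its pointwise action on the sections of `E`. -/
  ρ₀_compat : ∀ (a : E.diagSections) (f h : E.sections),
    (∀ x y : M, h.1 (x, y) = E.mul (a.1 x) (f.1 (x, y))) →
      ρ (completion.ι h) = ρ₀ a * ρ (completion.ι f)

attribute [instance] FellBundle.Representation.normedH FellBundle.Representation.innerH
  FellBundle.Representation.completeH

/-- A path-lifting operator: a continuous section of `E` supported on a global bisection
`{(φ x, x)}` of the pair groupoid, extended to a bounded operator on the Hilbert space. The path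
from `x` to `φ x` is lifted to `lift x`; by consistency the reflected path, from `φ x` to `x`, is
lifted to the adjoint of `lift x`. -/
structure FellBundle.PathLifting {M : Type u} [TopologicalSpace M] (E : FellBundle M)
    (R : E.Representation) where
  φ : M ≃ₜ M
  lift : ∀ x : M, E.Fib (φ x, x)
  continuous_lift : Continuous (fun x => (⟨(φ x, x), lift x⟩ : Tot E.Fib))
  consistent : ∀ x : M,
    (⟨(φ (φ x), φ x), lift (φ x)⟩ : Tot E.Fib) = E.totAdj ⟨(φ x, x), lift x⟩
  PL : R.H →L[ℂ] R.H
  /-- The operator extends the section: it acts by multiplying sections of `E` by it. -/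
  extends_lift : ∀ f h : E.sections,
    (∀ x z : M, h.1 (φ x, z) = E.mul (lift x) (f.1 (x, z))) →
      R.ρ (R.completion.ι h) = PL * R.ρ (R.completion.ι f)

/-- The section of the bundle along the bisection, as a map into the total space. -/
def FellBundle.PathLifting.arrow {M : Type u} [TopologicalSpace M] {E : FellBundle M}
    {R : E.Representation} (L : E.PathLifting R) (x : M) : Tot E.Fib :=
  ⟨(L.φ x, x), L.lift x⟩

/-- A Fell bundle triple `(E, H, PL)` whose base is a compact, second countable Hausdorff space
in the class `P` (for instance the class of simply connected manifolds). -/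
structure FellBundleTriple (P : ∀ (M : Type u) [TopologicalSpace M], Prop) where
  M : Type u
  [topM : TopologicalSpace M]
  [compactM : CompactSpace M]
  [t2M : T2Space M]
  [secondCountableM : SecondCountableTopology M]
  base_mem : P M
  E : FellBundle M
  unital : E.IsUnital
  saturated : E.IsSaturated
  R : E.Representation
  L : E.PathLifting R

attribute [instance] FellBundleTriple.topM FellBundleTriple.compactM FellBundleTriple.t2M
  FellBundleTriple.secondCountableM

namespace FellBundleTriple

variable {P : ∀ (M : Type u) [TopologicalSpace M], Prop}

/-- A morphism of Fell bundle triples: a continuous, fibrewise linear, multiplicative, involutive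
and unital bundle map, over a continuous map of the bases, which carries the path-lifting section
of the first triple to that of the second. -/
@[ext]
structure Hom (S T : FellBundleTriple P) where
  base : S.M → T.M
  map : ∀ x y : S.M, S.E.Fib (x, y) →ₗ[ℂ] T.E.Fib (base x, base y)
  continuous_base : Continuous base
  continuous_map : Continuous (fun e : Tot S.E.Fib =>
    (⟨(base e.base.1, base e.base.2), map e.base.1 e.base.2 e.val⟩ : Tot T.E.Fib))
  map_mul : ∀ {x y z : S.M} (a : S.E.Fib (x, y)) (b : S.E.Fib (y, z)),
    map x z (S.E.mul a b) = T.E.mul (map x y a) (map y z b)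
  map_adj : ∀ {x y : S.M} (a : S.E.Fib (x, y)), map y x (S.E.adj a) = T.E.adj (map x y a)
  map_identity : ∀ {x : S.M} (a : S.E.Fib (x, x)), S.E.IsIdentity a → T.E.IsIdentity (map x x a)
  map_lift : ∀ x : S.M,
    (⟨(base (S.L.φ x), base x), map (S.L.φ x) x (S.L.lift x)⟩ : Tot T.E.Fib) = T.L.arrow (base x)

/-- The identity morphism. -/
def Hom.id (S : FellBundleTriple P) : Hom S S where
  base := fun x => x
  map := fun _ _ => LinearMap.id
  continuous_base := continuous_id
  continuous_map := continuous_id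
  map_mul := fun _ _ => rfl
  map_adj := fun _ => rfl
  map_identity := fun _ h => h
  map_lift := fun _ => rfl

/-- Composition of morphisms. -/
def Hom.comp {S T U : FellBundleTriple P} (F : Hom S T) (G : Hom T U) : Hom S U where
  base := fun x => G.base (F.base x)
  map := fun x y => (G.map (F.base x) (F.base y)).comp (F.map x y)
  continuous_base := G.continuous_base.comp F.continuous_base
  continuous_map := G.continuous_map.comp F.continuous_map
  map_mul := fun a b => by simp [F.map_mul, G.map_mul]
  map_adj := fun a => by simp [F.map_adj, G.map_adj]
  map_identity := fun a h => G.map_identity _ (F.map_identity a h)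
  map_lift := fun x => by
    have h1 := congrArg (fun e : Tot T.E.Fib => (⟨(G.base e.base.1, G.base e.base.2),
      G.map e.base.1 e.base.2 e.val⟩ : Tot U.E.Fib)) (F.map_lift x)
    exact h1.trans (G.map_lift (F.base x))

instance : Category.{u} (FellBundleTriple P) where
  Hom := Hom
  id := Hom.id
  comp := Hom.comp

end FellBundleTriple

/-! ### C*-categories -/

/-- A C*-category. -/
class CStarCategory (C : Type u) [Category.{u} C] where
  [normed : ∀ x y : C, NormedAddCommGroup (x ⟶ y)]
  [space : ∀ x y : C, NormedSpace ℂ (x ⟶ y)]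
  complete : ∀ x y : C, CompleteSpace (x ⟶ y)
  add_comp : ∀ {x y z : C} (f g : x ⟶ y) (h : y ⟶ z), (f + g) ≫ h = f ≫ h + g ≫ h
  comp_add : ∀ {x y z : C} (f : x ⟶ y) (g h : y ⟶ z), f ≫ (g + h) = f ≫ g + f ≫ h
  smul_comp : ∀ {x y z : C} (t : ℂ) (f : x ⟶ y) (g : y ⟶ z), (t • f) ≫ g = t • (f ≫ g)
  comp_smul : ∀ {x y z : C} (t : ℂ) (f : x ⟶ y) (g : y ⟶ z), f ≫ (t • g) = t • (f ≫ g)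
  norm_comp_le : ∀ {x y z : C} (f : x ⟶ y) (g : y ⟶ z), ‖f ≫ g‖ ≤ ‖g‖ * ‖f‖
  adj : ∀ {x y : C}, (x ⟶ y) → (y ⟶ x)
  adj_add : ∀ {x y : C} (f g : x ⟶ y), adj (f + g) = adj f + adj g
  adj_smul : ∀ {x y : C} (t : ℂ) (f : x ⟶ y), adj (t • f) = (starRingEnd ℂ t) • adj f
  adj_adj : ∀ {x y : C} (f : x ⟶ y), adj (adj f) = f
  adj_id : ∀ x : C, adj (𝟙 x) = 𝟙 x
  adj_comp : ∀ {x y z : C} (f : x ⟶ y) (g : y ⟶ z), adj (f ≫ g) = adj g ≫ adj f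
  norm_comp_adj : ∀ {x y : C} (f : x ⟶ y), ‖f ≫ adj f‖ = ‖f‖ ^ 2
  comp_adj_pos : ∀ {x y : C} (f : x ⟶ y), ∃ b : x ⟶ x, f ≫ adj f = b ≫ adj b

attribute [reducible] CStarCategory.normed CStarCategory.space

attribute [instance] CStarCategory.normed CStarCategory.space

/-- A C*-category is full if all its hom-bimodules are full: the products of morphisms `x ⟶ y` with
morphisms `y ⟶ x` span a dense subspace of the algebra of endomorphisms of `x`. -/
def CStarCategory.IsFull (C : Type u) [Category.{u} C] [CStarCategory C] : Prop :=
  ∀ x y : C, Dense (Submodule.span ℂ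
    (Set.range (fun p : (x ⟶ y) × (y ⟶ x) => p.1 ≫ p.2)) : Set (x ⟶ x))

/-- The family of homsets `C_{xy} = Hom(y, x)`, indexed by the maximal equivalence relation
on the objects. -/
abbrev HomFam (C : Type u) [Category.{u} C] : C × C → Type u := fun g => (g.2 ⟶ g.1)

/-- A C*-category with a space of objects, fibred over the maximal equivalence relation on it: the
morphisms form a Banach bundle with continuous composition and involution. -/
class FibredCStarCategory (C : Type u) [Category.{u} C] [TopologicalSpace C] extends
    CStarCategory C where
  [top : TopologicalSpace (Tot (HomFam C))]
  banach : IsBanachBundle (HomFam C)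
  continuous_comp : Continuous (fun p : Composable (HomFam C) =>
    (⟨(p.x, p.z), (show p.z ⟶ p.y from p.right) ≫ (show p.y ⟶ p.x from p.left)⟩ : Tot (HomFam C)))
  continuous_adj : Continuous (fun e : Tot (HomFam C) =>
    (⟨(e.base.2, e.base.1), CStarCategory.adj e.val⟩ : Tot (HomFam C)))

attribute [reducible] FibredCStarCategory.top

attribute [instance] FibredCStarCategory.top

namespace Tot

variable {C : Type u} [Category.{u} C]

/-- The domain map of a category. -/
def dom (e : Tot (HomFam C)) : C := e.base.2

/-- The range map of a category. -/
def ran (e : Tot (HomFam C)) : C := e.base.1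

/-- The involution of a C*-category, on the set of all morphisms. -/
def star [CStarCategory C] (e : Tot (HomFam C)) : Tot (HomFam C) :=
  ⟨(e.base.2, e.base.1), CStarCategory.adj e.val⟩

end Tot

/-- A spectral C*-category: a small full C*-category with a continuous global self-adjoint section
`σ` of its domain map such that `r ∘ σ` is bijective. The space of objects is a compact, second
countable Hausdorff space in the class `P`. -/
structure SpectralCStarCategory (P : ∀ (M : Type u) [TopologicalSpace M], Prop) where
  Ob : Type u
  [topOb : TopologicalSpace Ob]
  [compactOb : CompactSpace Ob]
  [t2Ob : T2Space Ob]
  [secondCountableOb : SecondCountableTopology Ob]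
  base_mem : P Ob
  [cat : Category.{u} Ob]
  [cstar : FibredCStarCategory Ob]
  full : CStarCategory.IsFull Ob
  σ : Ob → Tot (HomFam Ob)
  continuous_σ : Continuous σ
  dom_σ : ∀ x, (σ x).dom = x
  bijective_σ : Function.Bijective (fun x => (σ x).ran)
  /-- `σ` equals its adjoint, the section `σ*` with `σ*(r(σ(x))) = σ(x)*`. -/
  selfAdjoint_σ : ∀ x, σ (σ x).ran = (σ x).star

attribute [instance] SpectralCStarCategory.topOb SpectralCStarCategory.compactOb
  SpectralCStarCategory.t2Ob SpectralCStarCategory.secondCountableOb SpectralCStarCategory.cat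
  SpectralCStarCategory.cstar

namespace SpectralCStarCategory

variable {P : ∀ (M : Type u) [TopologicalSpace M], Prop}

/-- The map induced by a functor on the set of all morphisms. -/
def totMap {C D : Type u} [Category.{u} C] [Category.{u} D] (F : C ⥤ D) (e : Tot (HomFam C)) :
    Tot (HomFam D) :=
  ⟨(F.obj e.base.1, F.obj e.base.2), F.map e.val⟩

/-- A morphism of spectral C*-categories: a continuous linear *-functor which carries the section
of the first to that of the second. -/
@[ext]
structure Hom (C D : SpectralCStarCategory P) where
  functor : C.Ob ⥤ D.Ob
  continuous_obj : Continuous functor.obj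
  continuous_map : Continuous (totMap functor)
  map_add : ∀ {x y : C.Ob} (f g : x ⟶ y), functor.map (f + g) = functor.map f + functor.map g
  map_smul : ∀ {x y : C.Ob} (t : ℂ) (f : x ⟶ y), functor.map (t • f) = t • functor.map f
  map_adj : ∀ {x y : C.Ob} (f : x ⟶ y),
    functor.map (CStarCategory.adj f) = CStarCategory.adj (functor.map f)
  map_σ : ∀ x : C.Ob, totMap functor (C.σ x) = D.σ (functor.obj x)

/-- The identity morphism. -/
def Hom.id (C : SpectralCStarCategory P) : Hom C C where
  functor := 𝟭 C.Ob
  continuous_obj := continuous_id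
  continuous_map := continuous_id
  map_add := fun _ _ => rfl
  map_smul := fun _ _ => rfl
  map_adj := fun _ => rfl
  map_σ := fun _ => rfl

/-- Composition of morphisms. -/
def Hom.comp {C D K : SpectralCStarCategory P} (F : Hom C D) (G : Hom D K) : Hom C K where
  functor := F.functor ⋙ G.functor
  continuous_obj := G.continuous_obj.comp F.continuous_obj
  continuous_map := G.continuous_map.comp F.continuous_map
  map_add := fun f g => by simp [F.map_add, G.map_add]
  map_smul := fun t f => by simp [F.map_smul, G.map_smul]
  map_adj := fun f => by simp [F.map_adj, G.map_adj]
  map_σ := fun x => (congrArg (totMap G.functor) (F.map_σ x)).trans (G.map_σ (F.functor.obj x))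

instance : Category.{u} (SpectralCStarCategory P) where
  Hom := Hom
  id := Hom.id
  comp := Hom.comp

end SpectralCStarCategory

/-! ### The spectral C*-category of a Fell bundle triple -/

namespace FellBundle

variable {M : Type u} [TopologicalSpace M]

/-- The category associated to a unital Fell bundle over the pair groupoid of `M`: its objects are
the points of `M`, and the morphisms from `y` to `x` are the elements of the fibre over `(x, y)`. -/
@[reducible]
noncomputable def category (E : FellBundle M) (h : E.IsUnital) : Category.{u} M where
  Hom := fun y x => E.Fib (x, y)
  id := fun x => E.one h x
  comp := fun f g => E.mul g f
  id_comp := fun f => E.mul_identity (E.one_isIdentity h _) f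
  comp_id := fun f => E.identity_mul (E.one_isIdentity h _) f
  assoc := fun f g k => (E.mul_assoc k g f).symm

theorem adj_one (E : FellBundle M) (h : E.IsUnital) (x : M) : E.adj (E.one h x) = E.one h x := by
  have h1 := E.mul_identity (E.one_isIdentity h x) (E.adj (E.one h x))
  have h2 := E.adj_mul (E.adj (E.one h x)) (E.one h x)
  rw [E.adj_adj, h1, E.adj_adj] at h2
  exact h2.symm

/-- The C*-category associated to a unital Fell bundle. -/
@[reducible]
noncomputable def fibredCStarCategory (E : FellBundle M) (h : E.IsUnital) :
    @FibredCStarCategory M (E.category h) _ :=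
  letI := E.category h
  { normed := fun y x => E.normed (x, y)
    space := fun y x => E.space (x, y)
    complete := fun y x => E.banach.complete (x, y)
    add_comp := fun f g k => E.mul_add k f g
    comp_add := fun f g k => E.add_mul g k f
    smul_comp := fun t f g => E.mul_smul t g f
    comp_smul := fun t f g => E.smul_mul t g f
    norm_comp_le := fun f g => E.norm_mul_le g f
    adj := fun f => E.adj f
    adj_add := fun f g => E.adj_add f g
    adj_smul := fun t f => E.adj_smul t f
    adj_adj := fun f => E.adj_adj f
    adj_id := fun x => E.adj_one h x
    adj_comp := fun f g => E.adj_mul g f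
    norm_comp_adj := fun f => E.norm_adj_mul f
    comp_adj_pos := fun f => E.adj_mul_pos f
    top := E.top
    banach := E.banach
    continuous_comp := E.continuous_mul
    continuous_adj := E.continuous_adj }

end FellBundle

namespace FellBundleTriple

variable {P : ∀ (M : Type u) [TopologicalSpace M], Prop}

/-- The spectral C*-category of a Fell bundle triple: the C*-category of the Fell bundle, with the
section underlying the path-lifting operator. -/
noncomputable def spectralCStarCategory (T : FellBundleTriple P) : SpectralCStarCategory P :=
  letI := T.E.category T.unital
  letI := T.E.fibredCStarCategory T.unital
  { Ob := T.M
    base_mem := T.base_mem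
    cat := T.E.category T.unital
    cstar := T.E.fibredCStarCategory T.unital
    full := fun x y => by
      have h := T.saturated x y x
      have hs : Set.range (fun p : T.E.Fib (x, y) × T.E.Fib (y, x) => T.E.mul p.1 p.2)
          = Set.range (fun p : (x ⟶ y) × (y ⟶ x) => p.1 ≫ p.2) := by
        ext a
        constructor
        · rintro ⟨p, rfl⟩
          exact ⟨(p.2, p.1), rfl⟩
        · rintro ⟨p, rfl⟩
          exact ⟨(p.2, p.1), rfl⟩
      rw [hs] at h
      exact h
    σ := fun x => T.L.arrow x
    continuous_σ := T.L.continuous_lift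
    dom_σ := fun _ => rfl
    bijective_σ := T.L.φ.bijective
    selfAdjoint_σ := fun x => T.L.consistent x }

/-- The functor from Fell bundle triples to spectral C*-categories. -/
noncomputable def toSpectral (P : ∀ (M : Type u) [TopologicalSpace M], Prop) :
    FellBundleTriple P ⥤ SpectralCStarCategory P where
  obj := spectralCStarCategory
  map := fun {S T} F =>
    { functor :=
        { obj := F.base
          map := fun {y x} a => F.map x y a
          map_id := fun x => (F.map_identity _ (S.E.one_isIdentity S.unital x)).eq
            (T.E.one_isIdentity T.unital (F.base x))
          map_comp := fun f g => F.map_mul g f }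
      continuous_obj := F.continuous_base
      continuous_map := F.continuous_map
      map_add := fun f g => (F.map _ _).map_add f g
      map_smul := fun t f => (F.map _ _).map_smul t f
      map_adj := fun f => F.map_adj f
      map_σ := fun x => F.map_lift x }

end FellBundleTriple

/-!
The operator of a path lifting and its section determine each other: the values of the continuous
sections are dense in every fibre, so the section can be recovered from the sections
`(φ x, z) ↦ e_x f (x, z)`, hence from their operators as the representation is faithful; and the
operator is determined by its products with the operators of the sections as these act
nondegenerately.

A morphism of Fell bundle triples consists of the same data as a `*`-functor, so only essential
surjectivity needs an argument: a spectral C*-category has the bundle and the section of a triple,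
but neither the Hilbert space nor the operator. For the Hilbert space, let `E_{(x, y)}` act from
`K_y` to `K_x`, where `K_x` is the Hilbert sum over the positive functionals `ω` on the units
`E_{(z, z)}` of the completions of `E_{(x, z)}` with respect to `ω (a* b)`. A summable family of
weights `s ≥ 0` with dense support gives the measure `∑ s(x)² δ_x` of full support, for which a
continuous section `f` acts on `⨁ K_x` by the matrix `s(x) s(y) f(x, y)`. If `s` is invariant under
the bisection, then multiplication by the section over the bisection is a bounded monomial operator
on `⨁ K_x`, and it restricts to the essential subspace of the represented algebra.
-/

/-! ### Continuous sections of Banach bundles -/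

theorem exists_partitionOfUnity_of_nhds {X : Type*} [TopologicalSpace X] [CompactSpace X]
    [T2Space X] {V : X → Set X} (hV : ∀ x, V x ∈ 𝓝 x) :
    ∃ (F : Finset X) (ψ : PartitionOfUnity F X), ψ.IsSubordinate fun x => V x := by
  obtain ⟨F, hF⟩ := isCompact_univ.elim_nhds_subcover (fun x => interior (V x))
    (fun x _ => interior_mem_nhds.2 (hV x))
  obtain ⟨ψ, hψ⟩ := PartitionOfUnity.exists_isSubordinate isClosed_univ
    (fun x : F => interior (V x)) (fun _ => isOpen_interior)
    (by simpa only [Set.iUnion_subtype] using hF.2)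
  exact ⟨F, ψ, fun x => (hψ x).trans interior_subset⟩

theorem norm_partitionOfUnity_sum_sub_le {X ι V : Type*} [TopologicalSpace X] [Fintype ι]
    [SeminormedAddCommGroup V] [NormedSpace ℝ V] (ψ : PartitionOfUnity ι X) {x : X} {v : ι → V}
    {w : V} {c : ℝ} (h : ∀ i, x ∈ tsupport (ψ i) → ‖v i - w‖ ≤ c) :
    ‖∑ i, ψ i x • v i - w‖ ≤ c := by
  have hmem := ψ.finsum_smul_mem_convex (g := fun i _ => v i) (t := Metric.closedBall w c)
    (Set.mem_univ x) (fun i hi => mem_closedBall_iff_norm.2 (h i (subset_tsupport _ hi)))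
    (convex_closedBall w c)
  rwa [finsum_eq_sum_of_fintype, mem_closedBall_iff_norm] at hmem

namespace IsBanachBundle

theorem exists_selection {X : Type u} {E : X → Type u} [∀ x, NormedAddCommGroup (E x)]
    {U : Set (Tot E)} {x : X} {b : E x}
    (hb : (⟨x, b⟩ : Tot E) ∈ U) :
    ∃ t : ∀ y, E y, t x = b ∧ ∀ y ∈ Tot.base '' U, (⟨y, t y⟩ : Tot E) ∈ U := by
  classical
  have hex : ∀ y, ∃ e : E y, y ∈ Tot.base '' U → (⟨y, e⟩ : Tot E) ∈ U := by
    intro y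
    by_cases hy : y ∈ Tot.base '' U
    · obtain ⟨⟨z, e⟩, he, rfl⟩ := hy
      exact ⟨e, fun _ => he⟩
    · exact ⟨0, fun h => absurd h hy⟩
  choose t ht using hex
  refine ⟨Function.update t x b, Function.update_self .., fun y hy => ?_⟩
  obtain rfl | hyx := eq_or_ne y x
  · simpa using hb
  · simpa [hyx] using ht y hy

section Approximation

variable {X : Type u} [TopologicalSpace X] {E : X → Type u} [∀ x, NormedAddCommGroup (E x)]
  [TopologicalSpace (Tot E)]

/-- Continuity at `x` up to an error `r`: near `x` the values of the section `s` are within any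
distance greater than `r` of elements of the total space close to `b`. For `r = 0` and `b = s x`
this is continuity of `s` at `x`. -/
def ApproxAt (r : ℝ) (s : ∀ x, E x) (x : X) (b : E x) : Prop :=
  ∀ ε > r, ∀ W ∈ 𝓝 (⟨x, b⟩ : Tot E), ∀ᶠ y in 𝓝 x, ∃ e : E y, (⟨y, e⟩ : Tot E) ∈ W ∧ ‖s y - e‖ < ε

theorem ApproxAt.mono {r r' : ℝ} {s : ∀ x, E x} {x : X} {b : E x} (h : ApproxAt r s x b)
    (hr : r ≤ r') : ApproxAt r' s x b :=
  fun ε hε W hW => h ε (lt_of_le_of_lt hr hε) W hW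

theorem ApproxAt.of_norm_sub_le {r c : ℝ} {s t : ∀ x, E x} {x : X} {b : E x}
    (h : ApproxAt r s x b) (hst : ∀ y, ‖t y - s y‖ ≤ c) : ApproxAt (r + c) t x b := by
  intro ε hε W hW
  filter_upwards [h (ε - c) (by linarith) W hW] with y ⟨e, he, hse⟩
  refine ⟨e, he, ?_⟩
  calc ‖t y - e‖ ≤ ‖t y - s y‖ + ‖s y - e‖ := norm_sub_le_norm_sub_add_norm_sub _ _ _
    _ < ε := by linarith [hst y]

theorem approxAt_of_continuousAt {s : ∀ x, E x} {x : X}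
    (h : ContinuousAt (fun y => (⟨y, s y⟩ : Tot E)) x) : ApproxAt 0 s x (s x) := by
  intro ε hε W hW
  filter_upwards [h hW] with y hy
  exact ⟨s y, hy, by simpa using hε⟩

variable [∀ x, NormedSpace ℂ (E x)]

theorem exists_nhds_add (hE : IsBanachBundle E) {x : X} {b c : E x} {W : Set (Tot E)}
    (hW : W ∈ 𝓝 (⟨x, b + c⟩ : Tot E)) :
    ∃ U ∈ 𝓝 (⟨x, b⟩ : Tot E), ∃ V ∈ 𝓝 (⟨x, c⟩ : Tot E), ∀ (y : X) (e f : E y),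
      (⟨y, e⟩ : Tot E) ∈ U → (⟨y, f⟩ : Tot E) ∈ V → (⟨y, e + f⟩ : Tot E) ∈ W := by
  have h := (hE.continuous_add.continuousAt (x := ⟨x, b, c⟩)).preimage_mem_nhds hW
  rw [nhds_induced, Filter.mem_comap] at h
  obtain ⟨t, ht, hts⟩ := h
  obtain ⟨U, hU, V, hV, hUV⟩ := mem_nhds_prod_iff.1 ht
  exact ⟨U, hU, V, hV, fun y e f he hf => hts (a := ⟨y, e, f⟩) (hUV ⟨he, hf⟩)⟩

theorem exists_nhds_smul (hE : IsBanachBundle E) {x : X} {t : ℂ} {b : E x} {W : Set (Tot E)}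
    (hW : W ∈ 𝓝 (⟨x, t • b⟩ : Tot E)) :
    ∃ U ∈ 𝓝 t, ∃ V ∈ 𝓝 (⟨x, b⟩ : Tot E), ∀ (y : X) (s : ℂ) (e : E y),
      s ∈ U → (⟨y, e⟩ : Tot E) ∈ V → (⟨y, s • e⟩ : Tot E) ∈ W := by
  have h := (hE.continuous_smul.continuousAt (x := (t, ⟨x, b⟩))).preimage_mem_nhds hW
  obtain ⟨U, hU, V, hV, hUV⟩ := mem_nhds_prod_iff.1 h
  exact ⟨U, hU, V, hV, fun y s e hs he => hUV (a := (s, ⟨y, e⟩)) ⟨hs, he⟩⟩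

theorem ApproxAt.add (hE : IsBanachBundle E) {r r' : ℝ} {s s' : ∀ x, E x} {x : X} {b b' : E x}
    (h : ApproxAt r s x b) (h' : ApproxAt r' s' x b') :
    ApproxAt (r + r') (fun y => s y + s' y) x (b + b') := by
  intro ε hε W hW
  obtain ⟨U, hU, V, hV, hUV⟩ := hE.exists_nhds_add hW
  filter_upwards [h (r + (ε - (r + r')) / 2) (by linarith) U hU,
    h' (r' + (ε - (r + r')) / 2) (by linarith) V hV] with y ⟨e, he, hse⟩ ⟨e', he', hse'⟩
  refine ⟨e + e', hUV y e e' he he', ?_⟩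
  calc ‖s y + s' y - (e + e')‖ = ‖(s y - e) + (s' y - e')‖ := by rw [add_sub_add_comm]
    _ ≤ ‖s y - e‖ + ‖s' y - e'‖ := norm_add_le _ _
    _ < ε := by linarith

theorem ApproxAt.smul (hE : IsBanachBundle E) {r : ℝ} {s : ∀ x, E x} {x : X} {b : E x}
    (h : ApproxAt r s x b) {ψ : X → ℂ} (hψ : ContinuousAt ψ x) :
    ApproxAt (‖ψ x‖ * r) (fun y => ψ y • s y) x (ψ x • b) := by
  intro ε hε W hW
  obtain ⟨U, hU, V, hV, hUV⟩ := hE.exists_nhds_smul hW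
  obtain ⟨r', hr', hlt⟩ : ∃ r' > r, ‖ψ x‖ * r' < ε := by
    have hev : ∀ᶠ r' in 𝓝[>] r, ‖ψ x‖ * r' < ε := nhdsWithin_le_nhds
      ((continuousAt_const.mul continuousAt_id).eventually_lt continuousAt_const hε)
    exact (eventually_mem_nhdsWithin.and hev).exists
  have hev : ∀ᶠ y in 𝓝 x, ‖ψ y‖ * r' < ε :=
    (hψ.norm.mul continuousAt_const).eventually_lt continuousAt_const hlt
  filter_upwards [h r' hr' V hV, hev, hψ hU] with y ⟨e, he, hse⟩ hy hyU
  refine ⟨ψ y • e, hUV y _ e hyU he, ?_⟩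
  rw [← smul_sub, norm_smul]
  exact lt_of_le_of_lt (mul_le_mul_of_nonneg_left hse.le (norm_nonneg _)) hy

theorem approxAt_zero_of_eventuallyEq {s : ∀ x, E x} {x : X} (hE : IsBanachBundle E)
    (hs : ∀ᶠ y in 𝓝 x, s y = 0) : ApproxAt 0 s x 0 := by
  intro ε hε W hW
  have hc : Continuous (fun x => (⟨x, 0⟩ : Tot E)) := (continuousSections hE).zero_mem
  filter_upwards [hs, hc.continuousAt.preimage_mem_nhds hW] with y hy hyW
  exact ⟨0, hyW, by simpa [hy] using hε⟩

theorem approxAt_norm_zero (hE : IsBanachBundle E) {x : X} (b : E x) :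
    ApproxAt ‖b‖ (fun _ => 0) x b := by
  intro ε hε W hW
  have h1 : {e : Tot E | ‖e.val‖ < ε} ∈ 𝓝 (⟨x, b⟩ : Tot E) :=
    (isOpen_lt hE.continuous_norm continuous_const).mem_nhds hε
  filter_upwards [hE.isOpenMap_proj.image_mem_nhds (Filter.inter_mem hW h1)] with y hy
  obtain ⟨⟨z, e⟩, ⟨he, he'⟩, rfl⟩ := hy
  exact ⟨e, he, by simpa using he'⟩

theorem ApproxAt.sum (hE : IsBanachBundle E) {ι : Type*} (I : Finset ι) {r : ι → ℝ}
    {s : ι → ∀ x, E x} {x : X} {b : ι → E x} (h : ∀ i ∈ I, ApproxAt (r i) (s i) x (b i)) :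
    ApproxAt (∑ i ∈ I, r i) (fun y => ∑ i ∈ I, s i y) x (∑ i ∈ I, b i) := by
  classical
  induction I using Finset.induction_on with
  | empty => simpa using approxAt_zero_of_eventuallyEq hE (s := fun _ => 0) (by simp)
  | insert i I hi ih =>
    simp only [Finset.sum_insert hi]
    exact (h i (Finset.mem_insert_self i I)).add hE
      (ih fun j hj => h j (Finset.mem_insert_of_mem hj))

theorem ApproxAt.continuousAt (hE : IsBanachBundle E) {s : ∀ x, E x} {x : X}
    (h : ApproxAt 0 s x (s x)) : ContinuousAt (fun y => (⟨y, s y⟩ : Tot E)) x := by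
  intro W (hW : W ∈ 𝓝 (⟨x, s x⟩ : Tot E))
  rw [← add_zero (s x)] at hW
  obtain ⟨U, hU, V, hV, hUV⟩ := hE.exists_nhds_add hW
  obtain ⟨⟨N, ε⟩, ⟨hN, hxN, hε⟩, hNV⟩ := (hE.nhds_zero x).mem_iff.1 hV
  rw [Filter.mem_map]
  filter_upwards [h ε hε U hU, hN.mem_nhds hxN] with y ⟨e, he, hse⟩ hyN
  simpa using hUV y e (s y - e) he (hNV ⟨hyN, hse⟩)

theorem mem_continuousSections_of_approxAt (hE : IsBanachBundle E) {s : ∀ x, E x}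
    (h : ∀ ε > 0, ∃ t : ∀ x, E x, (∀ x, ApproxAt ε t x (t x)) ∧ ∀ x, ‖s x - t x‖ ≤ ε) :
    s ∈ continuousSections hE := by
  refine continuous_iff_continuousAt.2 fun x => ApproxAt.continuousAt hE fun ε hε => ?_
  obtain ⟨t, ht, hst⟩ := h (ε / 4) (by positivity)
  have h1 := ((ht x).add hE (approxAt_norm_zero hE (s x - t x))).of_norm_sub_le (t := s)
    (c := ε / 4) (by simpa using hst)
  rw [add_sub_cancel] at h1
  exact h1 ε (by linarith [hst x])

theorem tsum_mem_continuousSections (hE : IsBanachBundle E) {ι : Type*} {f : ι → ∀ x, E x}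
    {u : ι → ℝ} (hf : ∀ i, f i ∈ continuousSections hE) (hu : Summable u)
    (hfu : ∀ i x, ‖f i x‖ ≤ u i) : (fun x => ∑' i, f i x) ∈ continuousSections hE := by
  refine hE.mem_continuousSections_of_approxAt fun ε hε => ?_
  obtain ⟨I, hI⟩ := (((tendsto_tsum_compl_atTop_zero u).eventually_lt_const hε)).exists
  refine ⟨fun x => ∑ i ∈ I, f i x, fun x => ?_, fun x => ?_⟩
  · have hsum : (∑ i ∈ I, f i) ∈ continuousSections hE := Submodule.sum_mem _ fun i _ => hf i
    have h := (approxAt_of_continuousAt (Continuous.continuousAt (x := x) hsum)).mono hε.le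
    simpa only [Finset.sum_fn, Finset.sum_apply] using h
  · have := hE.complete x
    have hfx : Summable fun i => f i x := .of_norm_bounded hu fun i => hfu i x
    rw [← hfx.sum_add_tsum_compl (s := I), add_sub_cancel_left]
    exact (tsum_of_norm_bounded (hu.subtype _).hasSum fun i => hfu i x).trans hI.le

theorem exists_thin_nhds (hE : IsBanachBundle E) (x : X) (b : E x) {r : ℝ} (hr : 0 < r) :
    ∃ U : Set (Tot E), IsOpen U ∧ (⟨x, b⟩ : Tot E) ∈ U ∧
      ∀ (y : X) (e f : E y), (⟨y, e⟩ : Tot E) ∈ U → (⟨y, f⟩ : Tot E) ∈ U → ‖e - f‖ < r := by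
  have h1 : {e : Tot E | ‖e.val‖ < r} ∈ 𝓝 (⟨x, b + (-1 : ℂ) • b⟩ : Tot E) :=
    (isOpen_lt hE.continuous_norm continuous_const).mem_nhds (by simpa using hr)
  obtain ⟨U, hU, V, hV, hUV⟩ := hE.exists_nhds_add h1
  obtain ⟨N, hN, V', hV', hNV⟩ := hE.exists_nhds_smul hV
  obtain ⟨O, hO, hOo, hxO⟩ := mem_nhds_iff.1 (Filter.inter_mem hU hV')
  refine ⟨O, hOo, hxO, fun y e f he hf => ?_⟩
  have := hUV y e ((-1 : ℂ) • f) (hO he).1 (hNV y _ f (mem_of_mem_nhds hN) (hO hf).2)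
  simpa [sub_eq_add_neg] using this

theorem exists_local_approx (hE : IsBanachBundle E) {x : X} (b : E x) {r : ℝ} (hr : 0 < r) :
    ∃ (U : Set (Tot E)) (t : ∀ y, E y), IsOpen U ∧ (⟨x, b⟩ : Tot E) ∈ U ∧ t x = b ∧
      (∀ y ∈ Tot.base '' U, ApproxAt r t y (t y)) ∧
      ∀ (y : X) (e : E y), (⟨y, e⟩ : Tot E) ∈ U → ‖t y - e‖ < r := by
  obtain ⟨U, hU, hxU, hthin⟩ := hE.exists_thin_nhds x b hr
  obtain ⟨t, htx, ht⟩ := exists_selection hxU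
  refine ⟨U, t, hU, hxU, htx, fun y hy ε hε W hW => ?_,
    fun y e he => hthin y _ _ (ht y ⟨_, he, rfl⟩) he⟩
  filter_upwards [hE.isOpenMap_proj.image_mem_nhds (Filter.inter_mem hW (hU.mem_nhds (ht y hy)))]
    with z hz
  obtain ⟨⟨z, e⟩, ⟨he, heU⟩, rfl⟩ := hz
  exact ⟨e, he, (hthin _ _ _ (ht _ ⟨_, heU, rfl⟩) heU).trans hε⟩

theorem ApproxAt.smul_of_tsupport_subset (hE : IsBanachBundle E) {r : ℝ} (hr : 0 ≤ r)
    {t : ∀ x, E x} {V : Set X} (ht : ∀ y ∈ V, ApproxAt r t y (t y)) (ψ : C(X, ℝ))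
    (hψ : tsupport ψ ⊆ V) (x : X) :
    ApproxAt (|ψ x| * r) (fun y => ψ y • t y) x (ψ x • t x) := by
  by_cases hx : x ∈ tsupport ψ
  · simpa using (ht x (hψ hx)).smul hE (ψ := fun y => (ψ y : ℂ)) (by fun_prop)
  · have h0 : ∀ᶠ y in 𝓝 x, ψ y = 0 := notMem_tsupport_iff_eventuallyEq.1 hx
    rw [h0.self_of_nhds, zero_smul]
    refine ApproxAt.mono (r := 0) (approxAt_zero_of_eventuallyEq hE ?_) (by positivity)
    filter_upwards [h0] with y hy
    rw [hy, zero_smul]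

theorem approxAt_partitionOfUnity_sum (hE : IsBanachBundle E) {ι : Type*} [Fintype ι]
    {V : ι → Set X} {ψ : PartitionOfUnity ι X} (hψ : ψ.IsSubordinate V) {r : ℝ} (hr : 0 ≤ r)
    {t : ι → ∀ x, E x} (ht : ∀ i, ∀ y ∈ V i, ApproxAt r (t i) y (t i y)) (x : X) :
    ApproxAt r (fun y => ∑ i, ψ i y • t i y) x (∑ i, ψ i x • t i x) := by
  refine (ApproxAt.sum hE Finset.univ fun i _ =>
    ApproxAt.smul_of_tsupport_subset hE hr (ht i) (ψ i) (hψ i) x).mono (le_of_eq ?_)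
  simp_rw [← Finset.sum_mul, abs_of_nonneg (ψ.nonneg _ x)]
  rw [← finsum_eq_sum_of_fintype, ψ.sum_eq_one (Set.mem_univ x), one_mul]

end Approximation

section CompactBase

variable {X : Type u} [TopologicalSpace X] [CompactSpace X] [T2Space X] {E : X → Type u}
  [∀ x, NormedAddCommGroup (E x)] [∀ x, NormedSpace ℂ (E x)] [TopologicalSpace (Tot E)]

theorem exists_refinement (hE : IsBanachBundle E) {r : ℝ} (hr : 0 < r)
    {s : ∀ x, E x} (hs : ∀ x, ApproxAt r s x (s x)) :
    ∃ t : ∀ x, E x, (∀ x, ApproxAt (r / 2) t x (t x)) ∧ ∀ x, ‖t x - s x‖ ≤ 3 * r := by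
  choose U t hU hxU _ ht htU using fun x => hE.exists_local_approx (s x) (half_pos hr)
  have hV : ∀ x, {y | y ∈ Tot.base '' U x ∧ ‖t x y - s y‖ < 3 * r} ∈ 𝓝 x := by
    intro x
    filter_upwards [(hE.isOpenMap_proj _ (hU x)).mem_nhds ⟨_, hxU x, rfl⟩,
      hs x (2 * r) (by linarith) (U x) ((hU x).mem_nhds (hxU x))] with y hy ⟨e, he, hse⟩
    refine ⟨hy, ?_⟩
    calc ‖t x y - s y‖ ≤ ‖t x y - e‖ + ‖e - s y‖ := norm_sub_le_norm_sub_add_norm_sub _ _ _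
      _ < 3 * r := by rw [norm_sub_rev e]; linarith [htU x y e he]
  obtain ⟨F, ψ, hψ⟩ := exists_partitionOfUnity_of_nhds hV
  exact ⟨fun y => ∑ i, ψ i y • t i y,
    hE.approxAt_partitionOfUnity_sum hψ (half_pos hr).le fun i y hy => ht i y hy.1,
    fun x => norm_partitionOfUnity_sum_sub_le ψ fun i hi => (hψ i hi).2.le⟩

theorem exists_seq_refinement (hE : IsBanachBundle E) {r : ℝ} (hr : 0 < r)
    {s : ∀ x, E x} (hs : ∀ x, ApproxAt r s x (s x)) :
    ∃ q : ℕ → ∀ x, E x, q 0 = s ∧ (∀ n x, ApproxAt (r / 2 ^ n) (q n) x (q n x)) ∧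
      ∀ n x, ‖q (n + 1) x - q n x‖ ≤ 3 * (r / 2 ^ n) := by
  choose! next hnext hdist using fun (n : ℕ) (s : ∀ x, E x)
    (hs : ∀ x, ApproxAt (r / 2 ^ n) s x (s x)) =>
      hE.exists_refinement (r := r / 2 ^ n) (by positivity) hs
  let q : ℕ → ∀ x, E x := fun n => Nat.rec s next n
  have hq : ∀ n x, ApproxAt (r / 2 ^ n) (q n) x (q n x) := by
    intro n
    induction n with
    | zero =>
      rw [pow_zero, div_one]
      exact hs
    | succ n ih => simpa only [div_div, ← pow_succ] using hnext n (q n) ih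
  exact ⟨q, rfl, hq, fun n => hdist n (q n) (hq n)⟩

theorem exists_mem_continuousSections_norm_sub_le (hE : IsBanachBundle E) {r : ℝ} (hr : 0 < r)
    {s : ∀ x, E x} (hs : ∀ x, ApproxAt r s x (s x)) :
    ∃ t ∈ continuousSections hE, ∀ x, ‖t x - s x‖ ≤ 6 * r := by
  obtain ⟨q, rfl, hq, hdist⟩ := hE.exists_seq_refinement hr hs
  have hd : ∀ x n, dist (q n x) (q (n + 1) x) ≤ (6 * r) / 2 / 2 ^ n := fun x n => by
    rw [dist_comm, dist_eq_norm]
    exact (hdist n x).trans (le_of_eq (by ring))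
  have hlim : ∀ x, ∃ l, Filter.Tendsto (fun n => q n x) Filter.atTop (𝓝 l) := fun x =>
    have := hE.complete x
    cauchySeq_tendsto_of_complete (cauchySeq_of_le_geometric_two (hd x))
  choose t ht using hlim
  have htq : ∀ n x, ‖t x - q n x‖ ≤ 6 * r / 2 ^ n := fun n x => by
    rw [← dist_eq_norm, dist_comm]
    exact dist_le_of_le_geometric_two_of_tendsto (hd x) (ht x) n
  refine ⟨t, hE.mem_continuousSections_of_approxAt fun ε hε => ?_, by simpa using htq 0⟩
  obtain ⟨n, hn⟩ : ∃ n : ℕ, 6 * r / 2 ^ n < ε :=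
    ((tendsto_const_nhds.div_atTop
      (tendsto_pow_atTop_atTop_of_one_lt one_lt_two)).eventually_lt_const hε).exists
  refine ⟨q n, fun x => (hq n x).mono (le_trans ?_ hn.le), fun x => (htq n x).trans hn.le⟩
  gcongr
  linarith

/-- The local sections through `b` are continuous only up to an error: one of them is cut off by a
bump function and then corrected to a continuous section. -/
theorem exists_mem_continuousSections_norm_apply_sub_le (hE : IsBanachBundle E) {x : X} (b : E x)
    {δ : ℝ} (hδ : 0 < δ) : ∃ t ∈ continuousSections hE, ‖t x - b‖ ≤ δ := by
  have hδ6 : 0 < δ / 6 := by positivity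
  obtain ⟨U, t, hU, hxU, rfl, ht, -⟩ := hE.exists_local_approx b hδ6
  obtain ⟨ρ, hρ⟩ := PartitionOfUnity.exists_isSubordinate (isClosed_singleton (x := x))
    (fun _ : Unit => Tot.base '' U) (fun _ => hE.isOpenMap_proj _ hU)
    (by simpa only [Set.iUnion_const, Set.singleton_subset_iff] using ⟨_, hxU, rfl⟩)
  have hρx : ρ () x = 1 := by
    simpa [finsum_eq_sum_of_fintype] using ρ.sum_eq_one (Set.mem_singleton x)
  obtain ⟨w, hw, hwt⟩ := hE.exists_mem_continuousSections_norm_sub_le hδ6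
    (s := fun y => ρ () y • t y) fun y =>
      (ApproxAt.smul_of_tsupport_subset hE hδ6.le ht (ρ ()) (hρ ()) y).mono (by
        rw [abs_of_nonneg (ρ.nonneg () y)]
        exact mul_le_of_le_one_left hδ6.le (ρ.le_one () y))
  refine ⟨w, hw, (le_of_eq ?_).trans ((hwt x).trans (by linarith))⟩
  rw [hρx, one_smul]

end CompactBase

end IsBanachBundle

/-! ### Positive functionals on the fibres over the units -/

open scoped ComplexOrder in
theorem exists_positiveLinearMap_ne_zero {A : Type*} [NonUnitalCStarAlgebra A] [PartialOrder A]
    [StarOrderedRing A] {a : A} (ha : 0 ≤ a) (ha' : a ≠ 0) : ∃ ω : A →ₚ[ℂ] ℂ, ω a ≠ 0 := by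
  have hneg : -a ∉ ProperCone.positive ℝ A := fun h =>
    ha' (le_antisymm (neg_nonneg.1 (by simpa using h)) ha)
  obtain ⟨f, hf, hfa⟩ := ProperCone.hyperplane_separation_point _ hneg
  let g : Module.Dual ℝ A := f.toLinearMap ∘ₗ
    (LinearMap.id + (starLinearEquiv ℝ (A := A)).toLinearMap)
  have hg : ∀ b, g b = f b + f (star b) := fun b => by simp [g]
  refine ⟨PositiveLinearMap.mk₀ g.extendRCLike fun b hb => Complex.nonneg_iff.2 ⟨?_, ?_⟩,
    fun h => ?_⟩
  · have hre := Module.Dual.re_extendRCLike_apply (𝕜 := ℂ) g b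
    rw [RCLike.re_eq_complex_re] at hre
    rw [hre, hg, hb.star_eq]
    linarith [hf b (by simpa using hb)]
  · have him := Module.Dual.im_extendRCLike_apply (𝕜 := ℂ) g b
    rw [RCLike.im_eq_complex_im, RCLike.I_to_complex] at him
    rw [him, hg, star_smul, hb.star_eq]
    simp
  · have hre := Module.Dual.re_extendRCLike_apply (𝕜 := ℂ) g a
    rw [RCLike.re_eq_complex_re] at hre
    have hga : g a = 0 := by rw [← hre]; exact congrArg Complex.re h
    rw [hg, ha.star_eq] at hga
    rw [map_neg] at hfa
    linarith

namespace FellBundle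

variable {M : Type u} [TopologicalSpace M]

/-- The fibre of a unital Fell bundle over a unit, as a C*-algebra. -/
def UnitFib (E : FellBundle M) (_ : E.IsUnital) (x : M) : Type u := E.Fib (x, x)

noncomputable instance (E : FellBundle M) (h : E.IsUnital) (x : M) :
    NormedRing (E.UnitFib h x) :=
  { E.normed (x, x) with
    mul := fun a b => E.mul (x := x) (y := x) (z := x) a b
    one := E.one h x
    left_distrib := fun a b c => E.mul_add a b c
    right_distrib := fun a b c => E.add_mul a b c
    zero_mul := fun a => by
      have := E.sub_mul (0 : E.Fib (x, x)) 0 (show E.Fib (x, x) from a)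
      rwa [sub_self, sub_self] at this
    mul_zero := fun a => by
      have := E.mul_sub (show E.Fib (x, x) from a) 0 (0 : E.Fib (x, x))
      rwa [sub_self, sub_self] at this
    mul_assoc := fun a b c => E.mul_assoc a b c
    one_mul := fun a => (E.one_isIdentity h x a).1
    mul_one := fun a => (E.one_isIdentity h x a).2
    norm_mul_le := fun a b => E.norm_mul_le a b }

noncomputable instance (E : FellBundle M) (h : E.IsUnital) (x : M) :
    NormedAlgebra ℂ (E.UnitFib h x) :=
  letI : Module ℂ (E.UnitFib h x) := (E.space (x, x)).toModule
  { Algebra.ofModule (R := ℂ) (A := E.UnitFib h x) (fun t a b => E.smul_mul t a b)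
      (fun t a b => E.mul_smul t a b) with
    norm_smul_le := (E.space (x, x)).norm_smul_le }

noncomputable instance (E : FellBundle M) (h : E.IsUnital) (x : M) :
    StarRing (E.UnitFib h x) where
  star := fun a => E.adj (x := x) (y := x) a
  star_involutive := fun a => E.adj_adj a
  star_mul := fun a b => E.adj_mul a b
  star_add := fun a b => E.adj_add a b

noncomputable instance (E : FellBundle M) (h : E.IsUnital) (x : M) :
    CStarAlgebra (E.UnitFib h x) where
  complete := (E.banach.complete (x, x)).complete
  norm_mul_self_le := fun a => ((E.norm_adj_mul (x := x) (y := x) a).trans (pow_two _)).ge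
  star_smul := fun t a => E.adj_smul t a

/-- A positive hermitian functional on the fibre over a unit. The definition makes sense without an
identity element; in a unital bundle being hermitian follows from positivity. -/
structure PosFunctional (E : FellBundle M) (z : M) where
  toLinearMap : E.Fib (z, z) →ₗ[ℂ] ℂ
  nonneg : ∀ b : E.Fib (z, z), 0 ≤ (toLinearMap (E.mul (E.adj b) b)).re
  hermitian : ∀ b : E.Fib (z, z), toLinearMap (E.adj b) = starRingEnd ℂ (toLinearMap b)

open scoped ComplexOrder in
theorem exists_posFunctional_ne_zero (E : FellBundle M) (h : E.IsUnital) {x y : M}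
    {a : E.Fib (x, y)} (ha : a ≠ 0) :
    ∃ ω : E.PosFunctional y, ω.toLinearMap (E.mul (E.adj a) a) ≠ 0 := by
  let _ := CStarAlgebra.spectralOrder (E.UnitFib h y)
  have := CStarAlgebra.spectralOrderedRing (E.UnitFib h y)
  obtain ⟨b, hb⟩ := E.adj_mul_pos a
  let b' : E.UnitFib h y := b
  have hb0 : star b' * b' ≠ 0 := fun h0 => ha (E.eq_zero_of_adj_mul a (hb.trans h0))
  obtain ⟨ω, hω⟩ := exists_positiveLinearMap_ne_zero (star_mul_self_nonneg b') hb0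
  refine ⟨⟨⟨⟨ω, fun a b => map_add ω _ _⟩, fun t a => map_smul ω t _⟩,
    fun (b : E.UnitFib h y) => ?_, fun (b : E.UnitFib h y) => ?_⟩, ?_⟩
  · exact (Complex.nonneg_iff.1 (ω.map_nonneg (star_mul_self_nonneg b))).1
  · exact map_star ω b
  · rw [hb]
    exact hω

theorem exists_norm_sq_smul_one_sub_eq (E : FellBundle M) (h : E.IsUnital) {x y : M}
    (c : E.Fib (x, y)) : ∃ d : E.Fib (y, y),
      ((‖c‖ ^ 2 : ℝ) : ℂ) • E.one h y - E.mul (E.adj c) c = E.mul (E.adj d) d := by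
  let _ := CStarAlgebra.spectralOrder (E.UnitFib h y)
  have := CStarAlgebra.spectralOrderedRing (E.UnitFib h y)
  obtain ⟨b, hb⟩ := E.adj_mul_pos c
  have h1 : ∀ a : E.UnitFib h y, star a * a ≤ algebraMap ℝ (E.UnitFib h y) (‖a‖ ^ 2) :=
    fun _ => CStarAlgebra.star_mul_le_algebraMap_norm_sq
  obtain ⟨d, hd⟩ := CStarAlgebra.nonneg_iff_eq_star_mul_self.1 (sub_nonneg.2 (h1 b))
  have hn : ‖c‖ ^ 2 = ‖b‖ ^ 2 := by rw [← E.norm_adj_mul, hb, E.norm_adj_mul]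
  refine ⟨d, ?_⟩
  rw [hb, hn]
  exact hd

namespace PosFunctional

variable {E : FellBundle M}

theorem re_adj_mul_nonneg {z : M} (ω : E.PosFunctional z) {x : M} (a : E.Fib (x, z)) :
    0 ≤ (ω.toLinearMap (E.mul (E.adj a) a)).re := by
  obtain ⟨b, hb⟩ := E.adj_mul_pos a
  rw [hb]
  exact ω.nonneg b

theorem re_adj_mul_mul_le (h : E.IsUnital) {z : M} (ω : E.PosFunctional z) {x y : M}
    (c : E.Fib (x, y)) (a : E.Fib (y, z)) :
    (ω.toLinearMap (E.mul (E.adj (E.mul c a)) (E.mul c a))).re ≤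
      ‖c‖ ^ 2 * (ω.toLinearMap (E.mul (E.adj a) a)).re := by
  obtain ⟨d, hd⟩ := E.exists_norm_sq_smul_one_sub_eq h c
  have hda : E.mul (E.adj (E.mul d a)) (E.mul d a) =
      ((‖c‖ ^ 2 : ℝ) : ℂ) • E.mul (E.adj a) a - E.mul (E.adj (E.mul c a)) (E.mul c a) := by
    rw [E.adj_mul, E.adj_mul, E.mul_assoc, ← E.mul_assoc _ d, ← hd, E.sub_mul, E.mul_sub,
      E.smul_mul, E.mul_smul, E.identity_mul (E.one_isIdentity h y), E.mul_assoc _ _ (E.mul c a),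
      ← E.mul_assoc (E.adj c)]
  have hpos := ω.re_adj_mul_nonneg (E.mul d a)
  rw [hda, map_sub, map_smul, Complex.sub_re, smul_eq_mul, Complex.re_ofReal_mul] at hpos
  linarith

end PosFunctional

end FellBundle

/-! ### Monomial operators between Hilbert sums -/

section Monomial

open scoped NNReal

theorem summable_norm_sq_of_lp_two {ι : Type*} {K : ι → Type*} [∀ i, NormedAddCommGroup (K i)]
    (ξ : lp K 2) : Summable fun i => ‖ξ i‖ ^ 2 := by
  simpa using (lp.memℓp ξ).summable (by norm_num)

theorem norm_sq_eq_tsum_of_lp_two {ι : Type*} {K : ι → Type*} [∀ i, NormedAddCommGroup (K i)]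
    (ξ : lp K 2) : ‖ξ‖ ^ 2 = ∑' i, ‖ξ i‖ ^ 2 := by
  simpa using lp.norm_rpow_eq_tsum (p := 2) (by norm_num) ξ

variable {ι κ 𝕜 : Type*} [NontriviallyNormedField 𝕜] {K : ι → Type*} {L : κ → Type*}
  [∀ i, NormedAddCommGroup (K i)] [∀ i, NormedSpace 𝕜 (K i)]
  [∀ k, NormedAddCommGroup (L k)] [∀ k, NormedSpace 𝕜 (L k)]
  (τ : ι ≃ κ) (b : ∀ i, L (τ i) →L[𝕜] K i) (C : ℝ≥0) (hb : ∀ i, ‖b i‖ ≤ C)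

include hb in
theorem norm_sq_apply_lp_le (ξ : lp L 2) (i : ι) :
    ‖b i (ξ (τ i))‖ ^ 2 ≤ (C : ℝ) ^ 2 * ‖ξ (τ i)‖ ^ 2 := by
  rw [← mul_pow]
  exact pow_le_pow_left₀ (norm_nonneg _) ((b i).le_of_opNorm_le (hb i) _) 2

include hb in
theorem summable_norm_sq_apply_lp (ξ : lp L 2) : Summable fun i => ‖b i (ξ (τ i))‖ ^ 2 :=
  (((summable_norm_sq_of_lp_two ξ).comp_injective τ.injective).mul_left _).of_nonneg_of_le
    (fun _ => by positivity) (norm_sq_apply_lp_le τ b C hb ξ)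

/-- The operator `(ξ_k) ↦ (b_i ξ_{τ i})` between Hilbert sums. For `τ = Equiv.refl ι` it is the
diagonal operator with entries `b_i`. -/
noncomputable def lpMonomial : lp L 2 →L[𝕜] lp K 2 :=
  LinearMap.mkContinuous
    { toFun := fun ξ => ⟨fun i => b i (ξ (τ i)), memℓp_gen (by
        simpa using summable_norm_sq_apply_lp τ b C hb ξ)⟩
      map_add' := fun ξ η => lp.ext (funext fun i => map_add (b i) _ _)
      map_smul' := fun t ξ => lp.ext (funext fun i => map_smul (b i) _ _) } C (fun ξ => by
        refine (sq_le_sq₀ (norm_nonneg _) (by positivity)).1 ?_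
        rw [mul_pow, norm_sq_eq_tsum_of_lp_two, norm_sq_eq_tsum_of_lp_two, ← τ.tsum_eq,
          ← tsum_mul_left]
        exact (summable_norm_sq_apply_lp τ b C hb ξ).tsum_le_tsum (norm_sq_apply_lp_le τ b C hb ξ)
          (((summable_norm_sq_of_lp_two ξ).comp_injective τ.injective).mul_left _))

theorem norm_lpMonomial_le : ‖lpMonomial τ b C hb‖ ≤ C :=
  LinearMap.mkContinuous_norm_le _ C.coe_nonneg _

end Monomial

/-! ### The universal representation -/

namespace FellBundle

variable {M : Type u} [TopologicalSpace M] {E : FellBundle M}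

namespace PosFunctional

variable {z : M} (ω : E.PosFunctional z)

/-- The fibre `E_{(x, z)}` with the semi-inner product `⟪a, b⟫ = ω (a* b)` given by a positive
functional `ω` on `E_{(z, z)}`, as in the Gelfand-Naimark-Segal construction. -/
@[nolint unusedArguments]
def PreFib (_ : E.PosFunctional z) (x : M) : Type u := E.Fib (x, z)

noncomputable instance (x : M) : AddCommGroup (ω.PreFib x) :=
  inferInstanceAs (AddCommGroup (E.Fib (x, z)))

noncomputable instance (x : M) : Module ℂ (ω.PreFib x) :=
  inferInstanceAs (Module ℂ (E.Fib (x, z)))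

/-- The identification of a fibre with the associated semi-inner product space. -/
noncomputable def toPre (x : M) : E.Fib (x, z) ≃ₗ[ℂ] ω.PreFib x :=
  LinearEquiv.refl ℂ _

/-- The semi-inner product `ω (a* b)`. -/
noncomputable abbrev preFibCore (x : M) : PreInnerProductSpace.Core ℂ (ω.PreFib x) where
  inner a b := ω.toLinearMap (E.mul (E.adj ((ω.toPre x).symm a)) ((ω.toPre x).symm b))
  conj_inner_symm a b := by rw [← ω.hermitian, E.adj_mul, E.adj_adj]
  re_inner_nonneg a := ω.re_adj_mul_nonneg _
  add_left a b c := by rw [map_add, E.adj_add, E.add_mul, map_add]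
  smul_left a b t := by rw [map_smul, E.adj_smul, E.smul_mul, map_smul, smul_eq_mul]

noncomputable instance (x : M) : SeminormedAddCommGroup (ω.PreFib x) :=
  InnerProductSpace.Core.toSeminormedAddCommGroup (c := ω.preFibCore x)

noncomputable instance (x : M) : InnerProductSpace ℂ (ω.PreFib x) :=
  InnerProductSpace.ofCore (ω.preFibCore x)

theorem inner_toPre (x : M) (a b : E.Fib (x, z)) :
    inner ℂ (ω.toPre x a) (ω.toPre x b) = ω.toLinearMap (E.mul (E.adj a) b) := rfl

theorem norm_toPre_sq (x : M) (a : E.Fib (x, z)) :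
    ‖ω.toPre x a‖ ^ 2 = (ω.toLinearMap (E.mul (E.adj a) a)).re := by
  rw [← inner_toPre, ← inner_self_eq_norm_sq (𝕜 := ℂ)]
  rfl

theorem norm_toPre_mul_le (h : E.IsUnital) {x y : M} (c : E.Fib (x, y)) (a : E.Fib (y, z)) :
    ‖ω.toPre x (E.mul c a)‖ ≤ ‖c‖ * ‖ω.toPre y a‖ := by
  refine (sq_le_sq₀ (norm_nonneg _) (by positivity)).1 ?_
  rw [mul_pow, norm_toPre_sq, norm_toPre_sq]
  exact ω.re_adj_mul_mul_le h c a

/-- Left multiplication by an element of a fibre, for the semi-inner product of `ω`. -/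
noncomputable def leftMul (h : E.IsUnital) {x y : M} (c : E.Fib (x, y)) :
    ω.PreFib y →L[ℂ] ω.PreFib x :=
  LinearMap.mkContinuous
    { toFun := fun a => ω.toPre x (E.mul c ((ω.toPre y).symm a))
      map_add' := fun a b => by rw [map_add, E.mul_add, map_add]
      map_smul' := fun t a => by rw [map_smul, E.mul_smul, map_smul, RingHom.id_apply] } ‖c‖
    (fun a => ω.norm_toPre_mul_le h c ((ω.toPre y).symm a))

/-- The Hilbert space completion of `PosFunctional.PreFib`. -/
abbrev HilbFib (x : M) : Type u := UniformSpace.Completion (ω.PreFib x)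

/-- The image of an element of a fibre in the Hilbert space completion. -/
noncomputable def toHilb (x : M) (a : E.Fib (x, z)) : ω.HilbFib x := (ω.toPre x a : ω.PreFib x)

theorem denseRange_toHilb (x : M) : DenseRange (ω.toHilb x) :=
  UniformSpace.Completion.denseRange_coe.comp (ω.toPre x).surjective.denseRange
    (UniformSpace.Completion.continuous_coe _)

theorem inner_toHilb (x : M) (a b : E.Fib (x, z)) :
    inner ℂ (ω.toHilb x a) (ω.toHilb x b) = ω.toLinearMap (E.mul (E.adj a) b) :=
  (UniformSpace.Completion.inner_coe _ _).trans (ω.inner_toPre x a b)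

theorem completion_leftMul_toHilb (h : E.IsUnital) {x y : M} (c : E.Fib (x, y))
    (a : E.Fib (y, z)) : (ω.leftMul h c).completion (ω.toHilb y a) = ω.toHilb x (E.mul c a) :=
  ContinuousLinearMap.completion_apply_coe _ _

theorem ext_toHilb {F : Type*} [NormedAddCommGroup F] [NormedSpace ℂ F] {x : M}
    {S T : ω.HilbFib x →L[ℂ] F} (hST : ∀ a, S (ω.toHilb x a) = T (ω.toHilb x a)) : S = T :=
  DFunLike.coe_injective
    ((ω.denseRange_toHilb x).equalizer S.continuous T.continuous (funext hST))

/-- The action of a fibre `E_{(x, y)}` between the Hilbert spaces of a positive functional. -/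
noncomputable def leftMulHilb (h : E.IsUnital) {x y : M} :
    E.Fib (x, y) →ₗ[ℂ] (ω.HilbFib y →L[ℂ] ω.HilbFib x) where
  toFun c := (ω.leftMul h c).completion
  map_add' c d := ω.ext_toHilb fun a => by
    simp only [_root_.add_apply, completion_leftMul_toHilb, E.add_mul]
    simp only [toHilb, map_add, UniformSpace.Completion.coe_add]
  map_smul' t c := ω.ext_toHilb fun a => by
    simp only [_root_.smul_apply, completion_leftMul_toHilb, E.smul_mul,
      RingHom.id_apply]
    simp only [toHilb, map_smul, UniformSpace.Completion.coe_smul]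

theorem leftMulHilb_toHilb (h : E.IsUnital) {x y : M} (c : E.Fib (x, y)) (a : E.Fib (y, z)) :
    ω.leftMulHilb h c (ω.toHilb y a) = ω.toHilb x (E.mul c a) :=
  ω.completion_leftMul_toHilb h c a

theorem norm_leftMulHilb_le (h : E.IsUnital) {x y : M} (c : E.Fib (x, y)) :
    ‖ω.leftMulHilb h c‖ ≤ ‖c‖ := by
  refine ContinuousLinearMap.opNorm_le_bound _ (norm_nonneg _) fun v => ?_
  induction v using (ω.denseRange_toHilb y).induction_on with
  | hp => exact isClosed_le (by fun_prop) (by fun_prop)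
  | ih a =>
    rw [leftMulHilb_toHilb, toHilb, toHilb, UniformSpace.Completion.norm_coe,
      UniformSpace.Completion.norm_coe]
    exact ω.norm_toPre_mul_le h c a

theorem leftMulHilb_mul (h : E.IsUnital) {x y w : M} (c : E.Fib (x, y)) (d : E.Fib (y, w)) :
    ω.leftMulHilb h (E.mul c d) = (ω.leftMulHilb h c).comp (ω.leftMulHilb h d) :=
  ω.ext_toHilb fun a => by
    simp only [ContinuousLinearMap.comp_apply, leftMulHilb_toHilb, E.mul_assoc]

theorem leftMulHilb_adj (h : E.IsUnital) {x y : M} (c : E.Fib (x, y)) :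
    ω.leftMulHilb h (E.adj c) = (ω.leftMulHilb h c).adjoint := by
  refine (ContinuousLinearMap.eq_adjoint_iff _ _).2 fun v w => ?_
  induction v using (ω.denseRange_toHilb x).induction_on with
  | hp => exact isClosed_eq (by fun_prop) (by fun_prop)
  | ih a =>
    induction w using (ω.denseRange_toHilb y).induction_on with
    | hp => exact isClosed_eq (by fun_prop) (by fun_prop)
    | ih b =>
      simp only [leftMulHilb_toHilb, inner_toHilb, E.adj_mul, E.adj_adj, E.mul_assoc]

theorem leftMulHilb_ne_zero (h : E.IsUnital) {x : M} {c : E.Fib (x, z)}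
    (hc : ω.toLinearMap (E.mul (E.adj c) c) ≠ 0) : ω.leftMulHilb h c ≠ 0 := by
  intro h0
  have hc0 : ω.toHilb x c = 0 := by
    rw [← E.mul_identity (E.one_isIdentity h z) c, ← ω.leftMulHilb_toHilb h, h0,
      _root_.zero_apply]
  rw [← ω.inner_toHilb, hc0, inner_zero_left] at hc
  exact hc rfl

end PosFunctional

/-- A faithful representation of a Fell bundle over a pair groupoid, seen as a C*-category, on a
family of Hilbert spaces. -/
structure HilbertRep (E : FellBundle M) where
  K : M → Type u
  [normed : ∀ x, NormedAddCommGroup (K x)]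
  [inner : ∀ x, InnerProductSpace ℂ (K x)]
  [complete : ∀ x, CompleteSpace (K x)]
  π : ∀ {x y : M}, E.Fib (x, y) →ₗ[ℂ] (K y →L[ℂ] K x)
  map_mul : ∀ {x y z : M} (a : E.Fib (x, y)) (b : E.Fib (y, z)), π (E.mul a b) = (π a).comp (π b)
  map_adj : ∀ {x y : M} (a : E.Fib (x, y)), π (E.adj a) = (π a).adjoint
  norm_le : ∀ {x y : M} (a : E.Fib (x, y)), ‖π a‖ ≤ ‖a‖
  eq_zero : ∀ {x y : M} (a : E.Fib (x, y)), π a = 0 → a = 0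

attribute [instance] HilbertRep.normed HilbertRep.inner HilbertRep.complete

/-- The action of a fibre `E_{(x, y)}` on the Hilbert sum over all positive functionals. -/
noncomputable def universalAction (h : E.IsUnital) {x y : M} (c : E.Fib (x, y)) :
    lp (fun i : Σ z, E.PosFunctional z => i.2.HilbFib y) 2 →L[ℂ]
      lp (fun i : Σ z, E.PosFunctional z => i.2.HilbFib x) 2 :=
  lpMonomial (Equiv.refl _) (fun i => i.2.leftMulHilb h c) ‖c‖₊
    fun i => i.2.norm_leftMulHilb_le h c

theorem universalAction_apply (h : E.IsUnital) {x y : M} (c : E.Fib (x, y))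
    (ξ : lp (fun i : Σ z, E.PosFunctional z => i.2.HilbFib y) 2) (i : Σ z, E.PosFunctional z) :
    universalAction h c ξ i = i.2.leftMulHilb h c (ξ i) := rfl

theorem universalAction_adj (h : E.IsUnital) {x y : M} (c : E.Fib (x, y)) :
    universalAction h (E.adj c) = (universalAction h c).adjoint := by
  refine (ContinuousLinearMap.eq_adjoint_iff _ _).2 fun ξ η => ?_
  rw [lp.inner_eq_tsum, lp.inner_eq_tsum]
  refine tsum_congr fun i => ?_
  rw [universalAction_apply, universalAction_apply, PosFunctional.leftMulHilb_adj,
    ContinuousLinearMap.adjoint_inner_left]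

theorem eq_zero_of_universalAction_eq_zero (h : E.IsUnital) {x y : M} {c : E.Fib (x, y)}
    (hc : universalAction h c = 0) : c = 0 := by
  classical
  by_contra hc0
  obtain ⟨ω, hω⟩ := E.exists_posFunctional_ne_zero h hc0
  refine ω.leftMulHilb_ne_zero h hω (ContinuousLinearMap.ext fun v => ?_)
  have hv := universalAction_apply h c
    (lp.single (E := fun i : Σ z, E.PosFunctional z => i.2.HilbFib y) 2 ⟨y, ω⟩ v) ⟨y, ω⟩
  rw [hc, lp.single_apply_self] at hv
  exact hv.symm

/-- The universal representation, on the Hilbert sums of the completions of the fibres with respect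
to all positive functionals. -/
noncomputable def universalRep (h : E.IsUnital) : E.HilbertRep where
  K x := lp (fun i : Σ z, E.PosFunctional z => i.2.HilbFib x) 2
  π :=
    { toFun := universalAction h
      map_add' := fun c d => ContinuousLinearMap.ext fun ξ => lp.ext <| funext fun i =>
        congrArg (· (ξ i)) ((i.2.leftMulHilb h).map_add c d)
      map_smul' := fun t c => ContinuousLinearMap.ext fun ξ => lp.ext <| funext fun i =>
        congrArg (· (ξ i)) ((i.2.leftMulHilb h).map_smul t c) }
  map_mul c d := ContinuousLinearMap.ext fun ξ => lp.ext <| funext fun i =>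
    congrArg (· (ξ i)) (i.2.leftMulHilb_mul h c d)
  map_adj c := universalAction_adj h c
  norm_le _ := norm_lpMonomial_le _ _ _ _
  eq_zero _ := eq_zero_of_universalAction_eq_zero h

end FellBundle

/-! ### Integral operators with kernels in a Fell bundle -/

open scoped NNReal

theorem summable_mul_prod {ι κ : Type*} {s : ι → ℝ≥0} {t : κ → ℝ≥0} (hs : Summable s)
    (ht : Summable t) : Summable fun p : ι × κ => s p.1 * t p.2 := by
  rw [← NNReal.summable_coe] at hs ht ⊢
  push_cast
  exact hs.mul_of_nonneg ht (fun _ => NNReal.coe_nonneg _) (fun _ => NNReal.coe_nonneg _)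

theorem summable_sq_of_summable {ι : Type*} {s : ι → ℝ≥0} (hs : Summable s) :
    Summable fun i => s i ^ 2 := by
  simp_rw [pow_two]
  exact NNReal.summable_comp_injective (summable_mul_prod hs hs) (i := fun i : ι => (i, i))
    fun _ _ h => congrArg Prod.fst h

theorem summable_smul_of_norm_le {ι F : Type*} [NormedAddCommGroup F] [NormedSpace ℂ F]
    [CompleteSpace F] {w : ι → ℝ≥0} (hw : Summable w) {v : ι → F} {C : ℝ} (hv : ∀ i, ‖v i‖ ≤ C) :
    Summable fun i => ((w i : ℝ) : ℂ) • v i := by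
  refine Summable.of_norm_bounded ((NNReal.summable_coe.2 hw).mul_right C) fun i => ?_
  rw [norm_smul, Complex.norm_real, NNReal.norm_eq]
  exact mul_le_mul_of_nonneg_left (hv i) (NNReal.coe_nonneg _)

namespace FellBundle

variable {M : Type u} [TopologicalSpace M] (E : FellBundle M)

/-- The convolution of two sections for the measure `∑ s(x)² δ_x`. -/
noncomputable def conv (s : M → ℝ≥0) (f g : ∀ p, E.Fib p) : ∀ p, E.Fib p :=
  fun p => ∑' y, (((s y ^ 2 : ℝ≥0) : ℝ) : ℂ) • E.mul (f (p.1, y)) (g (y, p.2))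

/-- The involution of the convolution algebra. -/
def sectionAdj (f : ∀ p, E.Fib p) : ∀ p, E.Fib p := fun p => E.adj (f (p.2, p.1))

/-- The product of a section supported on the bisection `{(x, φ x)}` with a section. -/
def bisectionMul (φ : M → M) (b : ∀ x, E.Fib (x, φ x)) (f : ∀ p, E.Fib p) : ∀ p, E.Fib p :=
  fun p => E.mul (b p.1) (f (φ p.1, p.2))

variable {E}

theorem norm_mul_le_of_norm_le {f g : ∀ p, E.Fib p} {C D : ℝ} (hf : ∀ p, ‖f p‖ ≤ C)
    (hg : ∀ p, ‖g p‖ ≤ D) (x y z : M) : ‖E.mul (f (x, y)) (g (y, z))‖ ≤ C * D :=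
  (E.norm_mul_le _ _).trans
    (mul_le_mul (hf _) (hg _) (norm_nonneg _) ((norm_nonneg _).trans (hf (x, y))))

namespace HilbertRep

variable (R : E.HilbertRep)

/-- The Hilbert sum of the spaces of a representation. -/
abbrev Total : Type u := lp R.K 2

open Classical in
/-- An element of the fibre over `(x, y)` as an operator on the Hilbert sum, whose matrix has this
element as its only nonzero entry. -/
noncomputable def matrixSingle {x y : M} : E.Fib (x, y) →L[ℂ] (R.Total →L[ℂ] R.Total) :=
  LinearMap.mkContinuous
    { toFun := fun c => (lp.singleContinuousLinearMap ℂ R.K 2 x).comp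
        ((R.π c).comp (lp.evalCLM ℂ R.K 2 y))
      map_add' := fun c d => by rw [map_add, ContinuousLinearMap.add_comp,
        ContinuousLinearMap.comp_add]
      map_smul' := fun t c => by rw [map_smul, ContinuousLinearMap.smul_comp,
        ContinuousLinearMap.comp_smul, RingHom.id_apply] } 1 (fun c => by
    refine ContinuousLinearMap.opNorm_le_bound _ (by positivity) fun ξ => ?_
    change ‖lp.single 2 x (R.π c (ξ y))‖ ≤ _
    rw [lp.norm_single (by norm_num), one_mul]
    exact ((R.π c).le_of_opNorm_le (R.norm_le c) _).trans
      (mul_le_mul_of_nonneg_left (lp.norm_apply_le_norm (by norm_num) ξ y) (norm_nonneg c)))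

open Classical in
theorem matrixSingle_apply {x y : M} (c : E.Fib (x, y)) (ξ : R.Total) :
    R.matrixSingle c ξ = lp.single 2 x (R.π c (ξ y)) := rfl

theorem norm_matrixSingle_le {x y : M} (c : E.Fib (x, y)) : ‖R.matrixSingle c‖ ≤ ‖c‖ := by
  simpa using (R.matrixSingle (x := x) (y := y)).le_of_opNorm_le
    (LinearMap.mkContinuous_norm_le _ zero_le_one _) c

theorem matrixSingle_mul {x y z : M} (c : E.Fib (x, y)) (d : E.Fib (y, z)) :
    R.matrixSingle c * R.matrixSingle d = R.matrixSingle (E.mul c d) := by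
  classical
  ext1 ξ
  rw [_root_.mul_apply_eq_comp, matrixSingle_apply, matrixSingle_apply, matrixSingle_apply,
    lp.single_apply_self, R.map_mul]
  rfl

theorem matrixSingle_mul_of_ne {x y y' z : M} (c : E.Fib (x, y)) (d : E.Fib (y', z))
    (h : y ≠ y') : R.matrixSingle c * R.matrixSingle d = 0 := by
  classical
  ext1 ξ
  rw [_root_.mul_apply_eq_comp, matrixSingle_apply, matrixSingle_apply,
    lp.single_apply_ne _ _ _ h, map_zero, lp.single_zero]
  rfl

theorem star_matrixSingle {x y : M} (c : E.Fib (x, y)) :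
    star (R.matrixSingle c) = R.matrixSingle (E.adj c) := by
  classical
  rw [ContinuousLinearMap.star_eq_adjoint]
  refine ((ContinuousLinearMap.eq_adjoint_iff _ _).2 fun ξ η => ?_).symm
  rw [matrixSingle_apply, matrixSingle_apply, lp.inner_single_left, lp.inner_single_right,
    R.map_adj, ContinuousLinearMap.adjoint_inner_left]

theorem eq_zero_of_matrixSingle_eq_zero {x y : M} {c : E.Fib (x, y)}
    (h : R.matrixSingle c = 0) : c = 0 := by
  classical
  refine R.eq_zero c (ContinuousLinearMap.ext fun v => ?_)
  have h1 := congrArg (fun T : R.Total →L[ℂ] R.Total => T (lp.single 2 y v) x) h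
  simp only [matrixSingle_apply, lp.single_apply_self] at h1
  exact h1

/-- The operator with kernel `s(x) s(y) f(x, y)`. Conjugated by the isometry `ξ ↦ (ξ_x / s(x))`, it
is the integral operator with kernel `f` for the measure `∑ s(x)² δ_x`. -/
noncomputable def kernelOp (s : M → ℝ≥0) (f : ∀ p, E.Fib p) : R.Total →L[ℂ] R.Total :=
  ∑' p : M × M, (((s p.1 * s p.2 : ℝ≥0) : ℝ) : ℂ) • R.matrixSingle (x := p.1) (y := p.2) (f p)

theorem kernelOp_smul (s : M → ℝ≥0) (t : ℂ) (f : ∀ p, E.Fib p) :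
    R.kernelOp s (t • f) = t • R.kernelOp s f := by
  rw [kernelOp, kernelOp, ← tsum_const_smul'']
  refine tsum_congr fun p => ?_
  rw [smul_comm t]
  exact congrArg _ (map_smul R.matrixSingle t _)

theorem kernelOp_sectionAdj (s : M → ℝ≥0) (f : ∀ p, E.Fib p) :
    R.kernelOp s (E.sectionAdj f) = star (R.kernelOp s f) := by
  rw [kernelOp, kernelOp, tsum_star, ← (Equiv.prodComm M M).tsum_eq]
  refine tsum_congr fun ⟨x, y⟩ => ?_
  rw [star_smul, star_matrixSingle, Complex.star_def, Complex.conj_ofReal]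
  change (((s y * s x : ℝ≥0) : ℝ) : ℂ) • _ = (((s x * s y : ℝ≥0) : ℝ) : ℂ) • _
  rw [mul_comm]
  rfl

section Weight

variable {s : M → ℝ≥0} (hs : Summable s) {f g : ∀ p, E.Fib p} {C D : ℝ} (hf : ∀ p, ‖f p‖ ≤ C)
  (hg : ∀ p, ‖g p‖ ≤ D)

include hs hf

theorem summable_kernelOp : Summable fun p : M × M =>
    (((s p.1 * s p.2 : ℝ≥0) : ℝ) : ℂ) • R.matrixSingle (x := p.1) (y := p.2) (f p) :=
  summable_smul_of_norm_le (summable_mul_prod hs hs) fun _ =>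
    (R.norm_matrixSingle_le _).trans (hf _)

theorem kernelOp_mul_matrixSingle {y z : M} (d : E.Fib (y, z)) :
    R.kernelOp s f * R.matrixSingle d =
      ∑' x, (((s x * s y : ℝ≥0) : ℝ) : ℂ) • R.matrixSingle (E.mul (f (x, y)) d) := by
  have hsum := R.summable_kernelOp hs hf
  rw [kernelOp, ← hsum.tsum_mul_right, (hsum.mul_right (R.matrixSingle d)).tsum_prod]
  refine tsum_congr fun x => ?_
  rw [tsum_eq_single y, smul_mul_assoc, matrixSingle_mul]
  intro y' hy
  rw [smul_mul_assoc, matrixSingle_mul_of_ne _ _ _ hy, smul_zero]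

theorem matrixSingle_one_mul_kernelOp_mul_matrixSingle_one (hE : E.IsUnital) (x y : M) :
    R.matrixSingle (E.one hE x) * (R.kernelOp s f * R.matrixSingle (E.one hE y)) =
      (((s x * s y : ℝ≥0) : ℝ) : ℂ) • R.matrixSingle (f (x, y)) := by
  have hsum : Summable fun x =>
      (((s x * s y : ℝ≥0) : ℝ) : ℂ) • R.matrixSingle (E.mul (f (x, y)) (E.one hE y)) := by
    refine summable_smul_of_norm_le (C := C) (hs.mul_right (s y)) fun x => ?_
    rw [E.mul_identity (E.one_isIdentity hE y)]
    exact (R.norm_matrixSingle_le _).trans (hf _)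
  rw [R.kernelOp_mul_matrixSingle hs hf, ← hsum.tsum_mul_left, tsum_eq_single x, mul_smul_comm,
    matrixSingle_mul, E.mul_identity (E.one_isIdentity hE y),
    E.identity_mul (E.one_isIdentity hE x)]
  intro x' hx'
  rw [mul_smul_comm, matrixSingle_mul_of_ne _ _ _ hx'.symm, smul_zero]

theorem apply_eq_zero_of_kernelOp_eq_zero (hE : E.IsUnital) (h : R.kernelOp s f = 0) {x y : M}
    (hx : s x ≠ 0) (hy : s y ≠ 0) : f (x, y) = 0 := by
  have hxy := R.matrixSingle_one_mul_kernelOp_mul_matrixSingle_one hs hf hE x y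
  rw [h, zero_mul, mul_zero] at hxy
  refine R.eq_zero_of_matrixSingle_eq_zero ((smul_eq_zero.1 hxy.symm).resolve_left ?_)
  exact_mod_cast mul_ne_zero hx hy

include hg

theorem kernelOp_add : R.kernelOp s (f + g) = R.kernelOp s f + R.kernelOp s g := by
  rw [kernelOp, kernelOp, kernelOp,
    ← (R.summable_kernelOp hs hf).tsum_add (R.summable_kernelOp hs hg)]
  refine tsum_congr fun p => ?_
  rw [← smul_add, ← map_add]
  rfl

theorem summable_conv (x z : M) :
    Summable fun y => (((s y ^ 2 : ℝ≥0) : ℝ) : ℂ) • E.mul (f (x, y)) (g (y, z)) := by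
  have := E.banach.complete (x, z)
  exact summable_smul_of_norm_le (summable_sq_of_summable hs) fun y =>
    norm_mul_le_of_norm_le hf hg x y z

theorem summable_kernelOp_conv : Summable fun q : (M × M) × M =>
    (((s q.1.1 * s q.1.2 * s q.2 ^ 2 : ℝ≥0) : ℝ) : ℂ) •
      R.matrixSingle (E.mul (f (q.1.1, q.2)) (g (q.2, q.1.2))) :=
  summable_smul_of_norm_le
    (summable_mul_prod (summable_mul_prod hs hs) (summable_sq_of_summable hs)) fun _ =>
      (R.norm_matrixSingle_le _).trans (norm_mul_le_of_norm_le hf hg _ _ _)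

theorem kernelOp_conv_eq_tsum : R.kernelOp s (E.conv s f g) = ∑' q : (M × M) × M,
    (((s q.1.1 * s q.1.2 * s q.2 ^ 2 : ℝ≥0) : ℝ) : ℂ) •
      R.matrixSingle (E.mul (f (q.1.1, q.2)) (g (q.2, q.1.2))) := by
  rw [(R.summable_kernelOp_conv hs hf hg).tsum_prod, kernelOp]
  refine tsum_congr fun ⟨x, z⟩ => ?_
  rw [conv, ContinuousLinearMap.map_tsum _ (summable_conv hs hf hg x z), ← tsum_const_smul'']
  refine tsum_congr fun y => ?_
  rw [map_smul, smul_smul, ← Complex.ofReal_mul, ← NNReal.coe_mul]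

theorem kernelOp_conv : R.kernelOp s (E.conv s f g) = R.kernelOp s f * R.kernelOp s g := by
  let e : (M × M) × M ≃ (M × M) × M :=
    { toFun := fun q => ((q.2, q.1.2), q.1.1)
      invFun := fun q => ((q.2, q.1.2), q.1.1)
      left_inv := fun _ => rfl
      right_inv := fun _ => rfl }
  have hsum := e.summable_iff.2 (R.summable_kernelOp_conv hs hf hg)
  rw [R.kernelOp_conv_eq_tsum hs hf hg, ← e.tsum_eq]
  refine hsum.tsum_prod.trans ?_
  rw [kernelOp.eq_def R s g,
    ← (R.summable_kernelOp hs hg).tsum_mul_left]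
  refine tsum_congr fun ⟨y, z⟩ => ?_
  rw [mul_smul_comm, R.kernelOp_mul_matrixSingle hs hf, ← tsum_const_smul'']
  refine tsum_congr fun x => ?_
  change (((s x * s z * s y ^ 2 : ℝ≥0) : ℝ) : ℂ) • _ = _
  rw [smul_smul, ← Complex.ofReal_mul, ← NNReal.coe_mul]
  congr 3
  ring

end Weight

section Bisection

variable (φ : M ≃ M) (b : ∀ x, E.Fib (x, φ x)) (B : ℝ≥0) (hb : ∀ x, ‖b x‖ ≤ B)

/-- The operator of multiplication by a bounded section over a bisection. -/
noncomputable def bisectionOp : R.Total →L[ℂ] R.Total :=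
  lpMonomial φ (fun x => R.π (b x)) B (fun x => (R.norm_le _).trans (hb x))

theorem bisectionOp_apply (ξ : R.Total) (x : M) :
    R.bisectionOp φ b B hb ξ x = R.π (b x) (ξ (φ x)) := rfl

theorem bisectionOp_mul_matrixSingle {x y : M} (c : E.Fib (φ x, y)) :
    R.bisectionOp φ b B hb * R.matrixSingle c = R.matrixSingle (E.mul (b x) c) := by
  classical
  refine ContinuousLinearMap.ext fun ξ => lp.ext (funext fun j => ?_)
  rw [_root_.mul_apply_eq_comp, bisectionOp_apply, matrixSingle_apply, matrixSingle_apply]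
  by_cases h : j = x
  · subst h
    rw [lp.single_apply_self, lp.single_apply_self, R.map_mul]
    rfl
  · rw [lp.single_apply_ne _ _ _ h, lp.single_apply_ne _ _ _ (φ.injective.ne h), map_zero]

theorem kernelOp_bisectionMul {s : M → ℝ≥0} (hs : Summable s) (hφ : ∀ x, s (φ x) = s x)
    {f : ∀ p, E.Fib p} {C : ℝ} (hf : ∀ p, ‖f p‖ ≤ C) :
    R.kernelOp s (E.bisectionMul φ b f) = R.bisectionOp φ b B hb * R.kernelOp s f := by
  rw [kernelOp.eq_def R s f, ← (R.summable_kernelOp hs hf).tsum_mul_left,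
    ← (Equiv.prodCongr φ (Equiv.refl M)).tsum_eq, kernelOp]
  refine tsum_congr fun ⟨x, y⟩ => ?_
  rw [mul_smul_comm]
  change (((s x * s y : ℝ≥0) : ℝ) : ℂ) • R.matrixSingle (E.mul (b x) (f (φ x, y))) =
    (((s (φ x) * s y : ℝ≥0) : ℝ) : ℂ) • (_ * R.matrixSingle (f (φ x, y)))
  rw [bisectionOp_mul_matrixSingle, hφ]

end Bisection

end HilbertRep

end FellBundle

/-! ### Compression to the essential subspace -/

section Compression

variable {H Γ : Type*} [NormedAddCommGroup H] [InnerProductSpace ℂ H]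

section Subspace

variable (W : Submodule ℂ H) [CompleteSpace W]

/-- The compression of an operator to a complete subspace. -/
noncomputable def compress : (H →L[ℂ] H) →ₗ[ℂ] (W →L[ℂ] W) where
  toFun B := W.orthogonalProjectionOnto.comp (B.comp W.subtypeL)
  map_add' B C := by rw [ContinuousLinearMap.add_comp, ContinuousLinearMap.comp_add]
  map_smul' t B := by rw [ContinuousLinearMap.smul_comp, ContinuousLinearMap.comp_smul]; rfl

theorem coe_compress_apply {B : H →L[ℂ] H} {w : W} (h : B w ∈ W) :
    (compress W B w : H) = B w :=
  Submodule.starProjection_eq_self_iff.2 h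

theorem compress_mul (B : H →L[ℂ] H) {C : H →L[ℂ] H} (hC : ∀ ξ, C ξ ∈ W) :
    compress W (B * C) = compress W B * compress W C := by
  ext1 w
  change W.orthogonalProjectionOnto (B (C w)) =
    W.orthogonalProjectionOnto (B ((compress W C w : W) : H))
  rw [coe_compress_apply W (hC w)]

theorem compress_star [CompleteSpace H] (B : H →L[ℂ] H) :
    compress W (star B) = star (compress W B) := by
  rw [ContinuousLinearMap.star_eq_adjoint, ContinuousLinearMap.star_eq_adjoint]
  refine (ContinuousLinearMap.eq_adjoint_iff _ _).2 fun v w => ?_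
  change inner ℂ (W.orthogonalProjectionOnto (B.adjoint v)) w =
    inner ℂ v (W.orthogonalProjectionOnto (B w))
  rw [Submodule.inner_orthogonalProjectionOnto_eq_of_mem_right,
    Submodule.inner_orthogonalProjectionOnto_eq_of_mem_left,
    ContinuousLinearMap.adjoint_inner_left]

end Subspace

variable (T : Γ → (H →L[ℂ] H))

/-- The closed span of the ranges of a family of operators. -/
def essentialSubspace : Submodule ℂ H :=
  (Submodule.span ℂ (Set.range fun p : Γ × H => T p.1 p.2)).topologicalClosure

theorem apply_mem_essentialSubspace (f : Γ) (ξ : H) : T f ξ ∈ essentialSubspace T :=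
  Submodule.le_topologicalClosure _ (Submodule.subset_span ⟨(f, ξ), rfl⟩)

theorem eq_zero_of_mem_essentialSubspace {v : H} (hv : v ∈ essentialSubspace T)
    (h : ∀ f ξ, inner ℂ (T f ξ) v = 0) : v = 0 := by
  have hspan : Submodule.span ℂ (Set.range fun p : Γ × H => T p.1 p.2) ≤ (ℂ ∙ v)ᗮ := by
    refine Submodule.span_le.2 ?_
    rintro _ ⟨⟨f, ξ⟩, rfl⟩
    exact Submodule.mem_orthogonal_singleton_iff_inner_left.2 (h f ξ)
  have hvv := Submodule.topologicalClosure_minimal _ hspan (Submodule.isClosed_orthogonal _) hv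
  exact inner_self_eq_zero.1 (Submodule.mem_orthogonal_singleton_iff_inner_left.1 hvv)

variable [CompleteSpace H]

instance : CompleteSpace (essentialSubspace T) :=
  (Submodule.isClosed_topologicalClosure _).completeSpace_coe

variable {T} (hstar : ∀ f, ∃ g, T g = star (T f))

include hstar

theorem eq_zero_of_compress_essentialSubspace_eq_zero {f : Γ}
    (h : compress (essentialSubspace T) (T f) = 0) : T f = 0 := by
  obtain ⟨g, hg⟩ := hstar f
  have hf : ∀ w ∈ essentialSubspace T, T f w = 0 := fun w hw => by
    have hw' := coe_compress_apply (essentialSubspace T) (w := ⟨w, hw⟩)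
      (apply_mem_essentialSubspace T f w)
    rw [h] at hw'
    exact hw'.symm
  have hg0 : T g = 0 := ContinuousLinearMap.ext fun w => by
    refine eq_zero_of_mem_essentialSubspace T (apply_mem_essentialSubspace T g w) fun f' ξ => ?_
    rw [hg, ContinuousLinearMap.star_eq_adjoint, ContinuousLinearMap.adjoint_inner_right,
      hf _ (apply_mem_essentialSubspace T f' ξ), inner_zero_left]
  exact star_eq_zero.1 (hg.symm.trans hg0)

theorem dense_span_compress_essentialSubspace : Dense (Submodule.span ℂ (Set.range
    fun p : Γ × essentialSubspace T => compress (essentialSubspace T) (T p.1) p.2) :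
      Set (essentialSubspace T)) := by
  rw [Submodule.dense_iff_topologicalClosure_eq_top, Submodule.topologicalClosure_eq_top_iff,
    Submodule.eq_bot_iff]
  intro v hv
  have horth : ∀ f, ∀ w ∈ essentialSubspace T, inner ℂ (T f w) (v : H) = 0 := fun f w hw => by
    have := (Submodule.mem_orthogonal _ _).1 hv _ (Submodule.subset_span ⟨(f, ⟨w, hw⟩), rfl⟩)
    rwa [Submodule.coe_inner, coe_compress_apply _ (apply_mem_essentialSubspace T f _)] at this
  have hker : ∀ f, T f v = 0 := fun f => by
    obtain ⟨g, hg⟩ := hstar f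
    have := horth g (T f v) (apply_mem_essentialSubspace T f v)
    rw [hg, ContinuousLinearMap.star_eq_adjoint, ContinuousLinearMap.adjoint_inner_left] at this
    exact inner_self_eq_zero.1 this
  refine Subtype.ext (eq_zero_of_mem_essentialSubspace T v.2 fun f ξ => ?_)
  obtain ⟨g, hg⟩ := hstar f
  rw [← ContinuousLinearMap.adjoint_inner_right, ← ContinuousLinearMap.star_eq_adjoint, ← hg,
    hker, inner_zero_right]

end Compression

/-! ### Atomic measures of full support -/

theorem exists_summable_support_eq {ι : Type*} {D : Set ι} (hD : D.Countable) :
    ∃ s : ι → ℝ≥0, Summable s ∧ Function.support s = D := by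
  have := hD.to_subtype
  obtain ⟨e, he, c, hc, -⟩ := NNReal.exists_pos_sum_of_countable one_ne_zero D
  refine ⟨Function.extend Subtype.val e 0,
    ((hasSum_extend_zero Subtype.val_injective).2 hc).summable, ?_⟩
  rw [Function.support_extend_zero Subtype.val_injective,
    Function.support_eq_univ fun d => (he d).ne', Set.image_univ, Subtype.range_coe]

theorem exists_invariant_weight {M : Type*} [TopologicalSpace M]
    [TopologicalSpace.SeparableSpace M] {φ : M → M} (hφ : Function.Involutive φ) :
    ∃ s : M → ℝ≥0, Summable s ∧ (∀ x, s (φ x) = s x) ∧ Dense (Function.support s) := by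
  obtain ⟨D, hD, hDd⟩ := TopologicalSpace.exists_countable_dense M
  obtain ⟨s, hs, rfl⟩ := exists_summable_support_eq hD
  refine ⟨fun x => s x + s (φ x), hs.add (NNReal.summable_comp_injective hs hφ.injective),
    fun x => ?_, hDd.mono fun x hx => ?_⟩
  · simp only [hφ x, add_comm]
  · exact (add_pos_of_pos_of_nonneg (pos_iff_ne_zero.2 hx) zero_le).ne'

section WeightMeasure

variable {M : Type*} [MeasurableSpace M] {s : M → ℝ≥0}

/-- The measure `∑ s(x)² δ_x`. -/
noncomputable def weightMeasure (s : M → ℝ≥0) : Measure M :=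
  Measure.sum fun d : Function.support s => ((s d ^ 2 : ℝ≥0) : ENNReal) • Measure.dirac (d : M)

theorem isFiniteMeasure_weightMeasure (hs : Summable s) : IsFiniteMeasure (weightMeasure s) := by
  have hsq : Summable fun d : Function.support s => s d ^ 2 :=
    NNReal.summable_comp_injective (summable_sq_of_summable hs) Subtype.val_injective
  refine ⟨?_⟩
  rw [weightMeasure, Measure.sum_apply _ MeasurableSet.univ]
  simp only [Measure.smul_apply, measure_univ, smul_eq_mul, mul_one]
  rw [← ENNReal.coe_tsum hsq]
  exact ENNReal.coe_lt_top

theorem integral_weightMeasure [MeasurableSingletonClass M] (hs : Summable s) {G : Type*}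
    [NormedAddCommGroup G] [NormedSpace ℂ G] [CompleteSpace G] {F : M → G} {C : ℝ}
    (hF : ∀ x, ‖F x‖ ≤ C) :
    ∫ y, F y ∂(weightMeasure s) = ∑' y, (((s y ^ 2 : ℝ≥0) : ℝ) : ℂ) • F y := by
  have : Countable (Function.support s) := hs.countable_support_nnreal.to_subtype
  rw [weightMeasure, integral_sum_dirac_eq_tsum (fun _ => ENNReal.coe_ne_top)]
  · refine (tsum_subtype_eq_of_support_subset (s := Function.support s)
      (f := fun y => (((s y ^ 2 : ℝ≥0) : ℝ) : ℂ) • F y) fun y hy hsy => hy ?_)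
    simp only [hsy, ne_eq, OfNat.ofNat_ne_zero, not_false_eq_true, zero_pow, NNReal.coe_zero,
      Complex.ofReal_zero, zero_smul]
  · refine Summable.of_nonneg_of_le (fun d => by positivity) (fun d => ?_)
      (((NNReal.summable_coe.2 (summable_sq_of_summable hs)).mul_right C).comp_injective
        Subtype.val_injective)
    exact mul_le_mul_of_nonneg_left (hF _) (NNReal.coe_nonneg _)

theorem isOpenPosMeasure_weightMeasure [TopologicalSpace M] [OpensMeasurableSpace M]
    (hd : Dense (Function.support s)) : (weightMeasure s).IsOpenPosMeasure := by
  refine ⟨fun U hU hne h0 => ?_⟩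
  obtain ⟨x, hxU, hx⟩ := hd.inter_open_nonempty U hU hne
  rw [weightMeasure, Measure.sum_apply _ hU.measurableSet, ENNReal.tsum_eq_zero] at h0
  have hx0 := h0 ⟨x, hx⟩
  rw [Measure.smul_apply, Measure.dirac_apply' _ hU.measurableSet, Set.indicator_of_mem hxU,
    Pi.one_apply, smul_eq_mul, mul_one, ENNReal.coe_eq_zero] at hx0
  exact hx (pow_eq_zero_iff two_ne_zero |>.1 hx0)

end WeightMeasure

/-! ### The regular representation -/

namespace FellBundle

variable {M : Type u} [TopologicalSpace M] (E : FellBundle M)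

theorem exists_norm_le_of_continuous {X : Type*} [TopologicalSpace X] [CompactSpace X]
    {f : X → Tot E.Fib} (hf : Continuous f) : ∃ C : ℝ≥0, ∀ x, ‖(f x).val‖ ≤ C := by
  obtain ⟨C, hC⟩ := isCompact_univ.exists_bound_of_continuousOn
    (E.banach.continuous_norm.comp hf).continuousOn
  refine ⟨C.toNNReal, fun x => le_trans ?_ (Real.le_coe_toNNReal C)⟩
  exact (Real.le_norm_self _).trans (hC x (Set.mem_univ x))

theorem exists_norm_le [CompactSpace M] (f : E.sections) : ∃ C : ℝ≥0, ∀ p, ‖f.1 p‖ ≤ C :=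
  E.exists_norm_le_of_continuous f.2

variable {E}

theorem continuous_mul_comp {X : Type*} [TopologicalSpace X] {x y z : X → M}
    {a : ∀ t, E.Fib (x t, y t)} {b : ∀ t, E.Fib (y t, z t)}
    (ha : Continuous fun t => (⟨(x t, y t), a t⟩ : Tot E.Fib))
    (hb : Continuous fun t => (⟨(y t, z t), b t⟩ : Tot E.Fib)) :
    Continuous fun t => (⟨(x t, z t), E.mul (a t) (b t)⟩ : Tot E.Fib) := by
  have h : Continuous fun t => (⟨x t, y t, z t, a t, b t⟩ : Composable E.Fib) :=
    continuous_induced_rng.2 (ha.prodMk hb)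
  exact E.continuous_mul.comp h

theorem sectionAdj_mem_sections {f : ∀ p, E.Fib p} (hf : f ∈ E.sections) :
    E.sectionAdj f ∈ E.sections :=
  E.continuous_adj.comp (Continuous.comp hf (continuous_snd.prodMk continuous_fst))

theorem bisectionMul_mem_sections {φ : M → M} (hφ : Continuous φ) {b : ∀ x, E.Fib (x, φ x)}
    (hb : Continuous fun x => (⟨(x, φ x), b x⟩ : Tot E.Fib)) {f : ∀ p, E.Fib p}
    (hf : f ∈ E.sections) : E.bisectionMul φ b f ∈ E.sections :=
  continuous_mul_comp (x := fun p : M × M => p.1) (y := fun p => φ p.1) (z := fun p => p.2)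
    (hb.comp continuous_fst)
    (Continuous.comp hf ((hφ.comp continuous_fst).prodMk continuous_snd))

theorem conv_mem_sections [CompactSpace M] {s : M → ℝ≥0} (hs : Summable s) (f g : E.sections) :
    E.conv s f.1 g.1 ∈ E.sections := by
  obtain ⟨C, hC⟩ := E.exists_norm_le f
  obtain ⟨D, hD⟩ := E.exists_norm_le g
  have hterm : ∀ y, (fun p : M × M => (((s y ^ 2 : ℝ≥0) : ℝ) : ℂ) •
      E.mul (f.1 (p.1, y)) (g.1 (y, p.2))) ∈ E.sections := fun y =>
    E.sections.smul_mem _ (continuous_mul_comp (x := fun p : M × M => p.1) (y := fun _ => y)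
      (z := fun p => p.2) (f.2.comp (continuous_fst.prodMk continuous_const))
      (g.2.comp (continuous_const.prodMk continuous_snd)))
  refine E.banach.tsum_mem_continuousSections hterm
    ((NNReal.summable_coe.2 (summable_sq_of_summable hs)).mul_right (C * D : ℝ)) fun y p => ?_
  rw [norm_smul, Complex.norm_real, NNReal.norm_eq]
  exact mul_le_mul_of_nonneg_left (norm_mul_le_of_norm_le hC hD _ _ _) (NNReal.coe_nonneg _)

theorem conv_eq_integral [CompactSpace M] [MeasurableSpace M] [MeasurableSingletonClass M]
    {s : M → ℝ≥0} (hs : Summable s) (f g : E.sections) (x z : M) :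
    E.conv s f.1 g.1 (x, z) = ∫ y, E.mul (f.1 (x, y)) (g.1 (y, z)) ∂(weightMeasure s) := by
  obtain ⟨C, hC⟩ := E.exists_norm_le f
  obtain ⟨D, hD⟩ := E.exists_norm_le g
  have := E.banach.complete (x, z)
  exact (integral_weightMeasure hs fun y => norm_mul_le_of_norm_le hC hD x y z).symm

variable (E) in
/-- A faithful nondegenerate representation of the convolution `*`-algebra of continuous sections
for the measure `∑ s(x)² δ_x`. -/
structure ConvolutionRep (s : M → ℝ≥0) where
  H : Type u
  [normedAddCommGroup : NormedAddCommGroup H]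
  [innerProductSpace : InnerProductSpace ℂ H]
  [completeSpace : CompleteSpace H]
  op : E.sections →ₗ[ℂ] (H →L[ℂ] H)
  map_conv : ∀ f g h : E.sections, h.1 = E.conv s f.1 g.1 → op h = op f * op g
  map_adj : ∀ f h : E.sections, h.1 = E.sectionAdj f.1 → op h = star (op f)
  injective : Function.Injective op
  nondegenerate : Dense (Submodule.span ℂ (Set.range fun p : E.sections × H => op p.1 p.2) : Set H)

namespace ConvolutionRep

attribute [instance] normedAddCommGroup innerProductSpace completeSpace

variable {s : M → ℝ≥0} (T : E.ConvolutionRep s)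

/-- The operator `A` is the action of the section `b` over the bisection `{(x, φ x)}`. -/
def Implements (φ : M → M) (b : ∀ x, E.Fib (x, φ x)) (A : T.H →L[ℂ] T.H) : Prop :=
  ∀ f h : E.sections, h.1 = E.bisectionMul φ b f.1 → T.op h = A * T.op f

theorem eq_of_mul_op {A B : T.H →L[ℂ] T.H} (h : ∀ f, A * T.op f = B * T.op f) : A = B := by
  refine ContinuousLinearMap.ext_on T.nondegenerate ?_
  rintro _ ⟨⟨f, ξ⟩, rfl⟩
  exact congrArg (fun X : T.H →L[ℂ] T.H => X ξ) (h f)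

theorem eq_of_star_op_mul_mul_op {A B : T.H →L[ℂ] T.H}
    (h : ∀ f g, star (T.op g) * (A * T.op f) = star (T.op g) * (B * T.op f)) : A = B := by
  refine T.eq_of_mul_op fun f => star_injective (T.eq_of_mul_op fun g => star_injective ?_)
  simpa only [star_mul, star_star] using h f g

section Units

variable (E) in
/-- The action of the sections over the units on the sections. -/
def diagMul (a : E.diagSections) (f : E.sections) : E.sections :=
  ⟨E.bisectionMul id a.1 f.1, bisectionMul_mem_sections continuous_id a.2 f.2⟩

variable {T} {a b : E.diagSections} {A B : T.H →L[ℂ] T.H}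

theorem Implements.op_diagMul (hA : T.Implements id a.1 A) (f : E.sections) :
    T.op (diagMul E a f) = A * T.op f :=
  hA f _ rfl

theorem Implements.eq_add {C : T.H →L[ℂ] T.H} (hA : T.Implements id a.1 A)
    (hB : T.Implements id b.1 B) (hC : T.Implements id (a + b).1 C) : C = A + B := by
  refine T.eq_of_mul_op fun f => ?_
  rw [_root_.add_mul, ← hA.op_diagMul, ← hB.op_diagMul, ← map_add]
  exact (hC f _ (funext fun p => (E.add_mul _ _ _).symm)).symm

theorem Implements.eq_smul {C : T.H →L[ℂ] T.H} (t : ℂ) (hA : T.Implements id a.1 A)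
    (hC : T.Implements id (t • a).1 C) : C = t • A := by
  refine T.eq_of_mul_op fun f => ?_
  rw [smul_mul_assoc, ← hA.op_diagMul, ← map_smul]
  exact (hC f _ (funext fun p => (E.smul_mul _ _ _).symm)).symm

theorem Implements.eq_mul {c : E.diagSections} {C : T.H →L[ℂ] T.H} (hA : T.Implements id a.1 A)
    (hB : T.Implements id b.1 B) (hC : T.Implements id c.1 C)
    (hc : ∀ x, c.1 x = E.mul (a.1 x) (b.1 x)) : C = A * B := by
  refine T.eq_of_mul_op fun f => ?_
  rw [_root_.mul_assoc, ← hB.op_diagMul, ← hA.op_diagMul]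
  refine (hC f _ (funext fun p => ?_)).symm
  exact (E.mul_assoc _ _ _).symm.trans (congrArg (E.mul · (f.1 p)) (hc p.1).symm)

theorem Implements.eq_star [CompactSpace M] (hs : Summable s) (hA : T.Implements id a.1 A)
    (hB : T.Implements id b.1 B) (hb : ∀ x, b.1 x = E.adj (a.1 x)) : B = star A := by
  have hop_adj (g : E.sections) :
      T.op ⟨_, sectionAdj_mem_sections g.2⟩ = star (T.op g) := T.map_adj g _ rfl
  refine T.eq_of_star_op_mul_mul_op fun f g => ?_
  let k : E.sections := ⟨_, conv_mem_sections hs ⟨_, sectionAdj_mem_sections g.2⟩ (diagMul E b f)⟩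
  have hk : k.1 = E.conv s (E.sectionAdj (diagMul E a g).1) f.1 := by
    refine funext fun p => tsum_congr fun y => congrArg _ ?_
    change E.mul (E.adj (g.1 (y, p.1))) (E.mul (b.1 y) (f.1 (y, p.2))) =
      E.mul (E.adj (E.mul (a.1 y) (g.1 (y, p.1)))) (f.1 (y, p.2))
    rw [hb, E.adj_mul, E.mul_assoc]
  calc star (T.op g) * (B * T.op f) = T.op k := by
        rw [← hB.op_diagMul, ← hop_adj]
        exact (T.map_conv _ _ k rfl).symm
    _ = star (T.op (diagMul E a g)) * T.op f := by
        rw [← hop_adj]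
        exact T.map_conv ⟨_, sectionAdj_mem_sections (diagMul E a g).2⟩ f k hk
    _ = star (T.op g) * (star A * T.op f) := by
        rw [hA.op_diagMul, star_mul, _root_.mul_assoc]

end Units

section Completion

variable [CompactSpace M] (hs : Summable s)

/-- The `*`-algebra of the operators of the sections. -/
noncomputable def operatorAlgebra : NonUnitalStarSubalgebra ℂ (T.H →L[ℂ] T.H) where
  carrier := Set.range T.op
  add_mem' := by
    rintro _ _ ⟨f, rfl⟩ ⟨g, rfl⟩
    exact ⟨f + g, map_add _ _ _⟩
  zero_mem' := ⟨0, map_zero _⟩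
  mul_mem' := by
    rintro _ _ ⟨f, rfl⟩ ⟨g, rfl⟩
    exact ⟨⟨_, conv_mem_sections hs f g⟩, T.map_conv f g _ rfl⟩
  smul_mem' := by
    rintro t _ ⟨f, rfl⟩
    exact ⟨t • f, map_smul _ _ _⟩
  star_mem' := by
    rintro _ ⟨f, rfl⟩
    exact ⟨⟨_, sectionAdj_mem_sections f.2⟩, T.map_adj f _ rfl⟩

variable [T2Space M]

/-- The closure of the operator algebra, as a C*-completion of the convolution algebra. -/
noncomputable def completion : E.Completion (@weightMeasure M (borel M) s) :=
  letI : MeasurableSpace M := borel M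
  haveI : BorelSpace M := ⟨rfl⟩
  haveI : IsClosed ((T.operatorAlgebra hs).topologicalClosure : Set (T.H →L[ℂ] T.H)) :=
    (T.operatorAlgebra hs).isClosed_topologicalClosure
  { Alg := (T.operatorAlgebra hs).topologicalClosure
    ι := T.op.codRestrict
      (T.operatorAlgebra hs).topologicalClosure.toNonUnitalSubalgebra.toSubmodule
      fun f => (T.operatorAlgebra hs).le_topologicalClosure ⟨f, rfl⟩
    injective := fun f g h => T.injective (congrArg Subtype.val h)
    denseRange := by
      rintro ⟨a, ha⟩
      refine closure_subtype.2 ?_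
      rw [← Set.range_comp]
      exact ha
    map_conv := fun f g h hh => Subtype.ext (T.map_conv f g h (funext fun p =>
      (hh p.1 p.2).trans (conv_eq_integral hs f g p.1 p.2).symm))
    map_star := fun f h hh => Subtype.ext (T.map_adj f h (funext fun p => hh p.1 p.2)) }

/-- A representation of the convolution algebra in which the sections over the units are
implemented by bounded operators, as a representation of a Fell bundle. -/
noncomputable def toRepresentation (hd : Dense (Function.support s))
    (D : E.diagSections → (T.H →L[ℂ] T.H)) (hD : ∀ a, T.Implements id a.1 (D a)) :
    E.Representation :=
  letI : MeasurableSpace M := borel M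
  haveI : BorelSpace M := ⟨rfl⟩
  { μ := weightMeasure s
    finite := isFiniteMeasure_weightMeasure hs
    openPos := isOpenPosMeasure_weightMeasure hd
    completion := T.completion hs
    H := T.H
    ρ := NonUnitalStarSubalgebraClass.subtype (T.operatorAlgebra hs).topologicalClosure
    faithful := Subtype.val_injective
    nondegenerate := T.nondegenerate.mono (Submodule.span_mono (by
      rintro _ ⟨⟨f, ξ⟩, rfl⟩
      exact ⟨((T.completion hs).ι f, ξ), rfl⟩))
    ρ₀ :=
      { toFun := D
        map_add' := fun a b => (hD a).eq_add (hD b) (hD (a + b))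
        map_smul' := fun t a => (hD a).eq_smul t (hD (t • a)) }
    ρ₀_mul := fun a b c hc => (hD a).eq_mul (hD b) (hD c) hc
    ρ₀_star := fun a b hb => (hD a).eq_star hs (hD b) hb
    ρ₀_compat := fun a f h hh => hD a f h (funext fun p => hh p.1 p.2) }

end Completion

section OfDegenerate

variable {H : Type u} [NormedAddCommGroup H] [InnerProductSpace ℂ H] [CompleteSpace H]
  (S : E.sections →ₗ[ℂ] (H →L[ℂ] H))
  (hconv : ∀ f g h : E.sections, h.1 = E.conv s f.1 g.1 → S h = S f * S g)
  (hadj : ∀ f h : E.sections, h.1 = E.sectionAdj f.1 → S h = star (S f))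
  (hinj : Function.Injective S)

/-- The restriction of a faithful, possibly degenerate, representation to its essential
subspace. -/
noncomputable def ofDegenerate : E.ConvolutionRep s :=
  have hstar (f : E.sections) : ∃ g, S g = star (S f) :=
    ⟨⟨_, sectionAdj_mem_sections f.2⟩, hadj f _ rfl⟩
  { H := essentialSubspace S
    op := (compress (essentialSubspace S)).comp S
    map_conv := fun f g h hh => (congrArg (compress _) (hconv f g h hh)).trans
      (compress_mul _ _ (apply_mem_essentialSubspace S g))
    map_adj := fun f h hh => (congrArg (compress _) (hadj f h hh)).trans (compress_star _ _)
    injective := (injective_iff_map_eq_zero _).2 fun _ hf =>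
      (map_eq_zero_iff S hinj).1 (eq_zero_of_compress_essentialSubspace_eq_zero hstar hf)
    nondegenerate := dense_span_compress_essentialSubspace hstar }

theorem implements_ofDegenerate {φ : M → M} {b : ∀ x, E.Fib (x, φ x)} {B : H →L[ℂ] H}
    (hB : ∀ f h : E.sections, h.1 = E.bisectionMul φ b f.1 → S h = B * S f) :
    (ofDegenerate S hconv hadj hinj).Implements φ b (compress (essentialSubspace S) B) :=
  fun f h hh => (congrArg (compress _) (hB f h hh)).trans
    (compress_mul _ _ (apply_mem_essentialSubspace S f))

end OfDegenerate

end ConvolutionRep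

namespace HilbertRep

variable [CompactSpace M] (R : E.HilbertRep) {s : M → ℝ≥0} (hs : Summable s)

/-- The operators with continuous kernels. -/
noncomputable def sectionOp : E.sections →ₗ[ℂ] (R.Total →L[ℂ] R.Total) where
  toFun f := R.kernelOp s f.1
  map_add' f g := by
    obtain ⟨C, hC⟩ := E.exists_norm_le f
    obtain ⟨D, hD⟩ := E.exists_norm_le g
    exact R.kernelOp_add hs hC hD
  map_smul' t f := R.kernelOp_smul s t f.1

theorem sectionOp_adj {f h : E.sections} (hh : h.1 = E.sectionAdj f.1) :
    R.sectionOp hs h = star (R.sectionOp hs f) :=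
  (congrArg (R.kernelOp s) hh).trans (R.kernelOp_sectionAdj s f.1)

theorem sectionOp_conv {f g h : E.sections} (hh : h.1 = E.conv s f.1 g.1) :
    R.sectionOp hs h = R.sectionOp hs f * R.sectionOp hs g := by
  obtain ⟨C, hC⟩ := E.exists_norm_le f
  obtain ⟨D, hD⟩ := E.exists_norm_le g
  exact (congrArg (R.kernelOp s) hh).trans (R.kernelOp_conv hs hC hD)

theorem eq_zero_of_sectionOp_eq_zero (hE : E.IsUnital) (hd : Dense (Function.support s))
    {f : E.sections} (h : R.sectionOp hs f = 0) : f = 0 := by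
  obtain ⟨C, hC⟩ := E.exists_norm_le f
  have hzero : ∀ p ∈ Function.support s ×ˢ Function.support s, ‖f.1 p‖ = 0 := fun p hp =>
    norm_eq_zero.2 (R.apply_eq_zero_of_kernelOp_eq_zero hs hC hE h hp.1 hp.2)
  have hnorm : (fun p => ‖f.1 p‖) = fun _ => 0 :=
    (E.banach.continuous_norm.comp f.2).ext_on (hd.prod hd) continuous_const hzero
  exact Subtype.ext (funext fun p => norm_eq_zero.1 (congrFun hnorm p))

/-- The operators with continuous kernels, on their essential subspace. -/
noncomputable def regularRep (hE : E.IsUnital) (hd : Dense (Function.support s)) :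
    E.ConvolutionRep s :=
  ConvolutionRep.ofDegenerate (R.sectionOp hs) (fun _ _ _ hh => R.sectionOp_conv hs hh)
    (fun _ _ hh => R.sectionOp_adj hs hh)
    ((injective_iff_map_eq_zero _).2 fun _ => R.eq_zero_of_sectionOp_eq_zero hs hE hd)

theorem exists_regularRep_implements (hE : E.IsUnital) (hd : Dense (Function.support s))
    (φ : M ≃ M) (hφ : ∀ x, s (φ x) = s x) {b : ∀ x, E.Fib (x, φ x)}
    (hb : Continuous fun x => (⟨(x, φ x), b x⟩ : Tot E.Fib)) :
    ∃ B, (R.regularRep hs hE hd).Implements φ b B := by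
  obtain ⟨C, hC⟩ := E.exists_norm_le_of_continuous hb
  refine ⟨_, ConvolutionRep.implements_ofDegenerate _ _ _ _ (B := R.bisectionOp φ b C hC) ?_⟩
  intro f h hh
  obtain ⟨D, hD⟩ := E.exists_norm_le f
  exact (congrArg (R.kernelOp s) hh).trans (R.kernelOp_bisectionMul φ b C hC hs hφ hD)

end HilbertRep

theorem exists_representation_implements [CompactSpace M] [T2Space M] [SecondCountableTopology M]
    (hE : E.IsUnital) {φ : M → M} (hφ : Function.Involutive φ) {b : ∀ x, E.Fib (x, φ x)}
    (hb : Continuous fun x => (⟨(x, φ x), b x⟩ : Tot E.Fib)) :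
    ∃ (R : E.Representation) (B : R.H →L[ℂ] R.H), ∀ f h : E.sections,
      h.1 = E.bisectionMul φ b f.1 → R.ρ (R.completion.ι h) = B * R.ρ (R.completion.ι f) := by
  obtain ⟨s, hs, hsφ, hd⟩ := exists_invariant_weight hφ
  let T := (universalRep hE).regularRep hs hE hd
  have hdiag (a : E.diagSections) : ∃ A, T.Implements id a.1 A :=
    (universalRep hE).exists_regularRep_implements hs hE hd (Equiv.refl M) (fun _ => rfl) a.2
  choose D hD using hdiag
  obtain ⟨B, hB⟩ := (universalRep hE).exists_regularRep_implements hs hE hd (hφ.toPerm φ) hsφ hb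
  exact ⟨T.toRepresentation hs hd D hD, B, hB⟩

end FellBundle

/-! ### Path-lifting operators and their sections -/

namespace FellBundle

variable {M : Type u} [TopologicalSpace M] {E : FellBundle M}

theorem totAdj_totAdj (e : Tot E.Fib) : E.totAdj (E.totAdj e) = e := by
  obtain ⟨⟨x, y⟩, a⟩ := e
  simp only [totAdj, E.adj_adj]

theorem forall_eq_mul_iff_eq_bisectionMul {φ : M → M} {e : ∀ x : M, E.Fib (φ x, x)}
    (he : ∀ x, (⟨(φ (φ x), φ x), e (φ x)⟩ : Tot E.Fib) = E.totAdj ⟨(φ x, x), e x⟩)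
    {f h : ∀ p, E.Fib p} :
    (∀ x z, h (φ x, z) = E.mul (e x) (f (x, z))) ↔
      h = E.bisectionMul φ (fun x => E.adj (e x)) f := by
  let IsProd (t : Tot E.Fib) : Prop := ∀ z, h (t.base.1, z) = E.mul t.val (f (t.base.2, z))
  have hiff : (∀ x, IsProd ⟨(φ x, x), e x⟩) ↔ ∀ x, IsProd (E.totAdj ⟨(φ x, x), e x⟩) := by
    refine ⟨fun hP x => he x ▸ hP (φ x), fun hP x => ?_⟩
    have hPx := hP (φ x)
    rwa [he, totAdj_totAdj] at hPx
  exact hiff.trans ⟨fun hP => funext fun p => hP p.1 p.2, fun hh x z => congrFun hh (x, z)⟩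

theorem eq_of_forall_mul_section_eq [CompactSpace M] [T2Space M] (hE : E.IsUnital) {x y : M}
    {a b : E.Fib (x, y)}
    (hab : ∀ f : E.sections, E.mul a (f.1 (y, y)) = E.mul b (f.1 (y, y))) : a = b := by
  obtain ⟨f, hf, hf1⟩ := E.banach.exists_mem_continuousSections_norm_apply_sub_le (E.one hE y)
    (δ := 1 / 2) (by norm_num)
  have hba : E.mul (a - b) (f (y, y) - E.one hE y) = b - a := by
    rw [E.mul_sub, E.mul_identity (E.one_isIdentity hE y), E.sub_mul, hab ⟨f, hf⟩, sub_self,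
      zero_sub, neg_sub]
  have hle : ‖a - b‖ ≤ ‖a - b‖ * (1 / 2) := calc
    ‖a - b‖ = ‖E.mul (a - b) (f (y, y) - E.one hE y)‖ := by rw [hba, norm_sub_rev]
    _ ≤ ‖a - b‖ * ‖f (y, y) - E.one hE y‖ := E.norm_mul_le _ _
    _ ≤ ‖a - b‖ * (1 / 2) := mul_le_mul_of_nonneg_left hf1 (norm_nonneg _)
  exact sub_eq_zero.1 (norm_eq_zero.1 (le_antisymm (by linarith) (norm_nonneg _)))

theorem Representation.eq_of_mul_section (R : E.Representation) {A B : R.H →L[ℂ] R.H}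
    (h : ∀ f : E.sections, A * R.ρ (R.completion.ι f) = B * R.ρ (R.completion.ι f)) : A = B := by
  have hρ : Continuous R.ρ := AddMonoidHomClass.continuous_of_bound R.ρ 1 fun a => by
    simpa only [one_mul] using NonUnitalStarAlgHom.norm_apply_le R.ρ a
  have hAB : (fun a => A * R.ρ a) = fun a => B * R.ρ a :=
    R.completion.denseRange.equalizer (by fun_prop) (by fun_prop) (funext h)
  refine ContinuousLinearMap.ext_on R.nondegenerate ?_
  rintro _ ⟨⟨a, ξ⟩, rfl⟩
  exact congrArg (fun X : R.H →L[ℂ] R.H => X ξ) (congrFun hAB a)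

namespace PathLifting

variable {R : E.Representation}

theorem exists_section_mul (L : E.PathLifting R) (f : E.sections) :
    ∃ h : E.sections, ∀ x z, h.1 (L.φ x, z) = E.mul (L.lift x) (f.1 (x, z)) :=
  ⟨⟨_, bisectionMul_mem_sections L.φ.continuous (E.continuous_adj.comp L.continuous_lift) f.2⟩,
    (forall_eq_mul_iff_eq_bisectionMul L.consistent).2 rfl⟩

theorem PL_eq_of_arrow_eq (L L' : E.PathLifting R) (h : ∀ x, L.arrow x = L'.arrow x) :
    L.PL = L'.PL := by
  refine R.eq_of_mul_section fun f => ?_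
  obtain ⟨g, hg⟩ := L.exists_section_mul f
  have hg' : ∀ x z, ∀ t, t = L.arrow x → g.1 (t.base.1, z) = E.mul t.val (f.1 (t.base.2, z)) := by
    rintro x z _ rfl
    exact hg x z
  exact (L.extends_lift f g hg).symm.trans
    (L'.extends_lift f g fun x z => hg' x z (L'.arrow x) (h x).symm)

theorem arrow_eq_of_PL_eq [CompactSpace M] [T2Space M] (hE : E.IsUnital)
    (L L' : E.PathLifting R) (hφ : L.φ = L'.φ) (h : L.PL = L'.PL) (x : M) :
    L.arrow x = L'.arrow x := by
  obtain ⟨φ', e', hc', he', B', hB'⟩ := L'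
  obtain rfl : L.φ = φ' := hφ
  obtain rfl : L.PL = B' := h
  have hx : L.lift x = e' x := by
    refine eq_of_forall_mul_section_eq hE fun f => ?_
    obtain ⟨g, hg⟩ := L.exists_section_mul f
    obtain ⟨g', hg'⟩ :=
      exists_section_mul ⟨L.φ, e', hc', he', L.PL, hB'⟩ f
    have hgg' : g = g' := R.completion.injective
      (R.faithful ((L.extends_lift f g hg).trans (hB' f g' hg').symm))
    exact (hg x x).symm.trans (hgg' ▸ hg' x x)
  simp only [arrow, hx]

end PathLifting

end FellBundle

/-! ### The equivalence -/

namespace FellBundle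

theorem isSaturated_of_full {M : Type u} [TopologicalSpace M] (E : FellBundle M)
    (h : E.IsUnital) (hfull : ∀ x y : M, Dense (Submodule.span ℂ
      (Set.range fun p : E.Fib (x, y) × E.Fib (y, x) => E.mul p.1 p.2) : Set (E.Fib (x, x)))) :
    E.IsSaturated := by
  intro x y z a
  let S := Submodule.span ℂ (Set.range fun p : E.Fib (x, y) × E.Fib (y, z) => E.mul p.1 p.2)
  let mulRight : E.Fib (x, x) →L[ℂ] E.Fib (x, z) := LinearMap.mkContinuous
    { toFun := fun b => E.mul b a
      map_add' := fun b c => E.add_mul b c a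
      map_smul' := fun t b => E.smul_mul t b a } ‖a‖ fun b => by
        rw [mul_comm]
        exact E.norm_mul_le b a
  have hle : Submodule.span ℂ (Set.range fun p : E.Fib (x, y) × E.Fib (y, x) => E.mul p.1 p.2) ≤
      S.comap mulRight.toLinearMap := by
    refine Submodule.span_le.2 ?_
    rintro _ ⟨⟨b, c⟩, rfl⟩
    exact Submodule.subset_span ⟨(b, E.mul c a), (E.mul_assoc b c a).symm⟩
  have hone : mulRight (E.one h x) ∈ closure (S : Set (E.Fib (x, z))) :=
    map_mem_closure mulRight.continuous (hfull x y (E.one h x)) fun b hb => hle hb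
  rwa [show mulRight (E.one h x) = a from E.identity_mul (E.one_isIdentity h x) a] at hone

end FellBundle

theorem functor_map_eq_of_mk_eq {C D : Type*} [Category* C] [Category* D] {o : C → D}
    {m m' : ∀ {X Y : C}, (X ⟶ Y) → (o X ⟶ o Y)} {hid hcomp hid' hcomp'}
    (h : (⟨o, m, hid, hcomp⟩ : C ⥤ D) = ⟨o, m', hid', hcomp'⟩) (X Y : C) (f : X ⟶ Y) :
    m f = m' f := by
  simpa using Functor.congr_hom h f

namespace FellBundleTriple

variable {P : ∀ (M : Type u) [TopologicalSpace M], Prop}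

instance : (toSpectral P).Faithful where
  map_injective := fun {S T} F G h => by
    obtain ⟨b, m, _, _, _, _, _, _⟩ := F
    obtain ⟨b', m', _, _, _, _, _, _⟩ := G
    have hfunctor := congrArg SpectralCStarCategory.Hom.functor h
    obtain rfl : b = b' := congrArg (fun F => F.obj) hfunctor
    obtain rfl : m = m' := funext fun x => funext fun y => LinearMap.ext fun a => 
      functor_map_eq_of_mk_eq (C := S.spectralCStarCategory.Ob)
        (D := T.spectralCStarCategory.Ob) hfunctor y x a
    rfl

instance : (toSpectral P).Full where
  map_surjective := fun {S T} F =>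
    ⟨{ base := F.functor.obj
       map := fun x y =>
        { toFun := fun a => F.functor.map (X := y) (Y := x) a
          map_add' := fun a b => F.map_add (x := y) (y := x) a b
          map_smul' := fun t a => F.map_smul (x := y) (y := x) t a }
       continuous_base := F.continuous_obj
       continuous_map := F.continuous_map
       map_mul := fun {x y z} a b => F.functor.map_comp (X := z) (Y := y) (Z := x) b a
       map_adj := fun {x y} a => F.map_adj (x := y) (y := x) a
       map_identity := fun {x} a ha => by
        obtain rfl : a = S.E.one S.unital x := ha.eq (S.E.one_isIdentity S.unital x)
        exact (congrArg (fun u : T.E.Fib (F.functor.obj x, F.functor.obj x) =>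
          T.E.IsIdentity u) (F.functor.map_id x)).mpr
            (T.E.one_isIdentity T.unital (F.functor.obj x))
       map_lift := F.map_σ }, rfl⟩

end FellBundleTriple

namespace FibredCStarCategory

variable (C : Type u) [Category.{u} C] [TopologicalSpace C] [FibredCStarCategory C]

/-- The morphisms of a fibred C*-category as a Fell bundle: the fibre over `(x, y)` is
`Hom(y, x)`, so that the product is the composition in the reverse order. -/
def fellBundle : FellBundle C where
  Fib := HomFam C
  normed := fun g => CStarCategory.normed g.2 g.1
  space := fun g => CStarCategory.space g.2 g.1
  top := FibredCStarCategory.top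
  banach := FibredCStarCategory.banach
  mul := fun {x y z} a b => (show z ⟶ y from b) ≫ (show y ⟶ x from a)
  adj := fun {x y} a => CStarCategory.adj (x := y) (y := x) a
  continuous_mul := FibredCStarCategory.continuous_comp
  continuous_adj := FibredCStarCategory.continuous_adj
  add_mul := fun a b c => CStarCategory.comp_add c a b
  mul_add := fun a b c => CStarCategory.add_comp b c a
  smul_mul := fun t a b => CStarCategory.comp_smul t b a
  mul_smul := fun t a b => CStarCategory.smul_comp t b a
  mul_assoc := fun a b c => (Category.assoc c b a).symm
  norm_mul_le := fun a b => CStarCategory.norm_comp_le b a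
  adj_add := CStarCategory.adj_add
  adj_smul := CStarCategory.adj_smul
  adj_adj := CStarCategory.adj_adj
  adj_mul := fun a b => CStarCategory.adj_comp b a
  norm_adj_mul := CStarCategory.norm_comp_adj
  adj_mul_pos := CStarCategory.comp_adj_pos

theorem isIdentity_fellBundle_id (x : C) :
    (fellBundle C).IsIdentity (show (fellBundle C).Fib (x, x) from 𝟙 x) := fun a =>
  ⟨Category.comp_id (X := x) (Y := x) a, Category.id_comp (X := x) (Y := x) a⟩

theorem isUnital_fellBundle : (fellBundle C).IsUnital := fun x => ⟨_, isIdentity_fellBundle_id C x⟩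

theorem one_fellBundle (x : C) : (fellBundle C).one (isUnital_fellBundle C) x = 𝟙 x :=
  ((fellBundle C).one_isIdentity _ x).eq (isIdentity_fellBundle_id C x)

theorem isSaturated_fellBundle (h : CStarCategory.IsFull C) : (fellBundle C).IsSaturated := by
  refine FellBundle.isSaturated_of_full _ (isUnital_fellBundle C) fun x y => ?_
  refine (h x y).mono (Submodule.span_mono ?_)
  rintro _ ⟨p, rfl⟩
  exact ⟨(p.2, p.1), rfl⟩

end FibredCStarCategory

namespace SpectralCStarCategory

open FibredCStarCategory

variable {P : ∀ (M : Type u) [TopologicalSpace M], Prop} (D : SpectralCStarCategory P)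

theorem ran_ran_σ (x : D.Ob) : (D.σ (D.σ x).ran).ran = x := by
  rw [D.selfAdjoint_σ]
  exact D.dom_σ x

theorem continuous_ran_σ : Continuous fun x => (D.σ x).ran :=
  continuous_fst.comp (FibredCStarCategory.banach.continuous_proj.comp D.continuous_σ)

/-- The bisection given by the ranges of the section. -/
def bisection : D.Ob ≃ₜ D.Ob where
  toFun := fun x => (D.σ x).ran
  invFun := fun x => (D.σ x).ran
  left_inv := D.ran_ran_σ
  right_inv := D.ran_ran_σ
  continuous_toFun := D.continuous_ran_σ
  continuous_invFun := D.continuous_ran_σ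

theorem exists_mk_eq_σ (x : D.Ob) : ∃ e : HomFam D.Ob (D.bisection x, x),
    (⟨(D.bisection x, x), e⟩ : Tot (HomFam D.Ob)) = D.σ x := by
  have hdom : ∀ t : Tot (HomFam D.Ob), t.dom = x →
      ∃ e : HomFam D.Ob (t.ran, x), (⟨(t.ran, x), e⟩ : Tot (HomFam D.Ob)) = t := by
    rintro ⟨⟨y, z⟩, a⟩ rfl
    exact ⟨a, rfl⟩
  exact hdom (D.σ x) (D.dom_σ x)

/-- The section as an element of the fibre over `(bisection x, x)`. -/
noncomputable def lift (x : D.Ob) : (fellBundle D.Ob).Fib (D.bisection x, x) :=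
  (D.exists_mk_eq_σ x).choose

theorem mk_lift (x : D.Ob) :
    (⟨(D.bisection x, x), D.lift x⟩ : Tot (fellBundle D.Ob).Fib) = D.σ x :=
  (D.exists_mk_eq_σ x).choose_spec

theorem continuous_lift :
    Continuous fun x => (⟨(D.bisection x, x), D.lift x⟩ : Tot (fellBundle D.Ob).Fib) :=
  D.continuous_σ.congr fun x => (D.mk_lift x).symm

theorem lift_consistent (x : D.Ob) :
    (⟨(D.bisection (D.bisection x), D.bisection x), D.lift (D.bisection x)⟩ :
      Tot (fellBundle D.Ob).Fib) = (fellBundle D.Ob).totAdj ⟨(D.bisection x, x), D.lift x⟩ := by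
  rw [mk_lift, mk_lift]
  exact D.selfAdjoint_σ x

theorem exists_pathLifting : ∃ (R : (fellBundle D.Ob).Representation)
    (L : (fellBundle D.Ob).PathLifting R), ∀ x, L.arrow x = D.σ x := by
  obtain ⟨R, B, hB⟩ := FellBundle.exists_representation_implements (isUnital_fellBundle D.Ob)
    (φ := D.bisection) D.ran_ran_σ ((fellBundle D.Ob).continuous_adj.comp D.continuous_lift)
  exact ⟨R,
    { φ := D.bisection
      lift := D.lift
      continuous_lift := D.continuous_lift
      consistent := D.lift_consistent
      PL := B
      extends_lift := fun f h hh =>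
        hB f h ((FellBundle.forall_eq_mul_iff_eq_bisectionMul D.lift_consistent).1 hh) },
    D.mk_lift⟩

/-- A Fell bundle triple over the objects of a spectral C*-category. -/
noncomputable def fellBundleTriple : FellBundleTriple P where
  M := D.Ob
  base_mem := D.base_mem
  E := fellBundle D.Ob
  unital := isUnital_fellBundle D.Ob
  saturated := isSaturated_fellBundle D.Ob D.full
  R := D.exists_pathLifting.choose
  L := D.exists_pathLifting.choose_spec.choose

/-- The spectral C*-category of `fellBundleTriple` is the given one; the identity morphisms agree
only propositionally, whence an isomorphism. -/
noncomputable def toSpectralIso : (FellBundleTriple.toSpectral P).obj D.fellBundleTriple ≅ D where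
  hom := show SpectralCStarCategory.Hom _ D from
    { functor :=
        { obj := fun x => x
          map := fun a => a
          map_id := one_fellBundle D.Ob
          map_comp := fun _ _ => rfl }
      continuous_obj := continuous_id
      continuous_map := continuous_id
      map_add := fun _ _ => rfl
      map_smul := fun _ _ => rfl
      map_adj := fun _ => rfl
      map_σ := D.exists_pathLifting.choose_spec.choose_spec }
  inv := show SpectralCStarCategory.Hom D _ from
    { functor :=
        { obj := fun x => x
          map := fun a => a
          map_id := fun x => (one_fellBundle D.Ob x).symm
          map_comp := fun _ _ => rfl }
      continuous_obj := continuous_id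
      continuous_map := continuous_id
      map_add := fun _ _ => rfl
      map_smul := fun _ _ => rfl
      map_adj := fun _ => rfl
      map_σ := fun x => (D.exists_pathLifting.choose_spec.choose_spec x).symm }
  hom_inv_id := rfl
  inv_hom_id := rfl

end SpectralCStarCategory

namespace FellBundleTriple

variable {P : ∀ (M : Type u) [TopologicalSpace M], Prop}

instance : (toSpectral P).EssSurj :=
  ⟨fun D => ⟨D.fellBundleTriple, ⟨D.toSpectralIso⟩⟩⟩

instance : (toSpectral P).IsEquivalence where

end FellBundleTriple

theorem mainTheorem2 (P : ∀ (M : Type u) [TopologicalSpace M], Prop) :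
    (FellBundleTriple.toSpectral P).IsEquivalence ∧
      ∀ (T : FellBundleTriple P) (L L' : T.E.PathLifting T.R), L.φ = L'.φ →
        (L.PL = L'.PL ↔ ∀ x : T.M, L.arrow x = L'.arrow x) :=
  ⟨inferInstance, fun T L L' hφ => ⟨L.arrow_eq_of_PL_eq T.unital L' hφ, L.PL_eq_of_arrow_eq L'⟩⟩
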